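/- Let $U\subset\mathbb R^2$ be a non-empty open set and let $h,H:U\to\mathbb R$ be smooth positive functions with $\Delta\ln H=(\ln H)_{xx}+(\ln H)_{yy}=2h^2$ on $U$. Put $l_2=-(\ln H)_y$, $n_2=(\ln H)_x$ and $\omega_\Sigma=h^2\,dx\wedge dy$. On $M=U\times\{(z,t)\in\mathbb R^2:z<0\}$ let $$\theta_3=-\tfrac z2\,dt+\big(\cos\tfrac t2\,H+z\,l_2\big)dx+\big(-\sin\tfrac t2\,H+z\,n_2\big)dy,\qquad \theta_4=dz-\sin\tfrac t2\,H\,dx-\cos\tfrac t2\,H\,dy,$$ and $g=z^2h^2(dx^2+dy^2)+\theta_3^2+\theta_4^2$. Then $g$ is a Riemannian metric on $M$, and $(M,g)$ admits a Kähler structure $\bar J$ with Kähler form $\bar\Omega=z^2\omega_\Sigma+\theta_4\wedge\theta_3$ and a Hermitian structure $J$ with Kähler form $\Omega=z^2\omega_\Sigma+\theta_3\wedge\theta_4$ (where $\Omega(X,Y)=g(JX,Y)$ and $\bar\Omega(X,Y)=g(\bar JX,Y)$), such that the following hold. (1) $\bar J$ is opposite to $J$: its Kähler form is anti-self-dual for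 the orientation of $J$. Moreover, with $\mathcal D=\{X:\nabla_XJ=0\}$, one has $\bar J=-J$ on $\mathcal D$ and $\bar J=J$ on $\mathcal D^\perp$. (2) The Ricci tensor $\rho$ is $J$-invariant, $\rho(JX,JY)=\rho(X,Y)$, and $(M,g,J)$ is not locally conformally Kähler. (3) The Lee form $\theta$ of $(M,g,J)$, defined by $d\Omega=2\theta\wedge\Omega$, is $\theta=-\alpha\theta_4$ with $\alpha=-\frac2z$. (4) The scalar curvature of $(M,g)$ is $\tau=-\dfrac{2\Delta\ln h}{z^2h^2}-\dfrac8{z^2}$, and it equals the conformal scalar curvature $\kappa=\tau-6(|\theta|^2+\delta\theta)$ of $(M,g,J)$. (5) $(M,g,\bar J)$ is a QCH Kähler surface with respect to $\mathcal D$: $\mathcal D$ is a smooth $\bar J$-invariant distribution of rank two, and the holomorphic curvature $R(X,\bar JX,\bar JX,X)$ of a unit tangent vector $X$ depends only on the base point and on the length of the orthogonal projection of $X$ onto $\mathcal D$. It is semi-symmetric: $R\cdot R=0$, and $J$ satisfies the first Gray condition $R(JX,JY,Z,W)=R(X,Y,Z,W)$. -/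

import Mathlib

open scoped ContDiff

noncomputable section

/-! ## Riemannian and Hermitian geometry on open subsets of `ℝ⁴`

A four-manifold which is an open subset of `ℝ⁴` has one global chart, so that tensor fields are
functions on `ℝ⁴` of which only the values on the open set `M` matter.  Tensors which arise from
an operation on vector fields (curvature, `∇J`, the Nijenhuis tensor) are evaluated on constant
vector fields, i.e. combinations of the coordinate fields; as the operations are tensorial this
gives the tensor itself. -/

/-- The coordinate space `ℝⁿ` (only its smooth structure is used). -/
abbrev Coord (n : ℕ) : Type := Fin n → ℝ

/-- Fields of bilinear forms on `ℝ⁴`: metrics, 2-forms, … -/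
abbrev BilinField : Type := Coord 4 → (Coord 4 →ₗ[ℝ] Coord 4 →ₗ[ℝ] ℝ)

/-- Fields of endomorphisms of the tangent spaces of `ℝ⁴`. -/
abbrev EndField : Type := Coord 4 → (Coord 4 →ₗ[ℝ] Coord 4)

/-- 1-forms on `ℝ⁴`. -/
abbrev OneForm : Type := Coord 4 → (Coord 4 →ₗ[ℝ] ℝ)

/-- Vector fields on `ℝ⁴`. -/
abbrev VecField : Type := Coord 4 → Coord 4

/-- The coordinate vector `∂ᵢ`. -/
def basisVec {n : ℕ} (i : Fin n) : Coord n := Pi.single i 1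

/-- The partial derivative `∂f/∂xᵢ`. -/
def partialDeriv {n : ℕ} (i : Fin n) (f : Coord n → ℝ) (p : Coord n) : ℝ :=
  fderiv ℝ f p (basisVec i)

/-- The derivative at `p` of the function `f` in the direction `X`. -/
def dirDeriv (f : Coord 4 → ℝ) (p X : Coord 4) : ℝ := fderiv ℝ f p X

/-- `g` is a (smooth) Riemannian metric on `M`. -/
structure IsRiemannianMetric (M : Set (Coord 4)) (g : BilinField) : Prop where
  smooth : ∀ X Y : Coord 4, ContDiffOn ℝ ∞ (fun p => g p X Y) M
  symm : ∀ p ∈ M, ∀ X Y, g p X Y = g p Y X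
  pos : ∀ p ∈ M, ∀ X, X ≠ 0 → 0 < g p X X

/-- The matrix `(gᵢⱼ)` of the metric. -/
def gramMatrix (g : BilinField) (p : Coord 4) : Matrix (Fin 4) (Fin 4) ℝ :=
  Matrix.of fun i j => g p (basisVec i) (basisVec j)

/-- The entries `gⁱʲ` of the inverse matrix. -/
def invMetric (g : BilinField) (p : Coord 4) (i j : Fin 4) : ℝ := (gramMatrix g p)⁻¹ i j

/-- The Christoffel symbols
`Γᵏᵢⱼ = ½ ∑ₗ gᵏˡ (∂ᵢ gⱼₗ + ∂ⱼ gᵢₗ - ∂ₗ gᵢⱼ)`. -/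
def christoffel (g : BilinField) (p : Coord 4) (i j k : Fin 4) : ℝ :=
  (1 / 2) * ∑ l : Fin 4, invMetric g p k l *
    (partialDeriv i (fun q => gramMatrix g q j l) p
      + partialDeriv j (fun q => gramMatrix g q i l) p
      - partialDeriv l (fun q => gramMatrix g q i j) p)

/-- The Levi-Civita connection: `(∇_X Y)ᵏ = X(Yᵏ) + ∑ᵢⱼ Γᵏᵢⱼ Xⁱ Yʲ`. -/
def leviCivita (g : BilinField) (X Y : VecField) : VecField := fun p =>
  fderiv ℝ Y p (X p) +
    fun k => ∑ i : Fin 4, ∑ j : Fin 4, christoffel g p i j k * X p i * Y p j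

/-- `([∇_X, ∇_Y] - ∇_{[X,Y]}) Z` for vector fields. -/
def curvatureField (g : BilinField) (X Y Z : VecField) : VecField := fun p =>
  leviCivita g X (leviCivita g Y Z) p - leviCivita g Y (leviCivita g X Z) p
    - leviCivita g (VectorField.lieBracket ℝ X Y) Z p

/-- The curvature tensor `R(X,Y)Z` at the point `p`. -/
def curvature (g : BilinField) (p X Y Z : Coord 4) : Coord 4 :=
  curvatureField g (fun _ => X) (fun _ => Y) (fun _ => Z) p

/-- `R(X,Y,Z,W) = g(R(X,Y)Z,W)`. -/
def curvature4 (g : BilinField) (p X Y Z W : Coord 4) : ℝ := g p (curvature g p X Y Z) W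

/-- The Ricci tensor `ρ(X,Y) = tr {Z ↦ R(Z,X)Y}`. -/
def ricci (g : BilinField) (p X Y : Coord 4) : ℝ :=
  ∑ i : Fin 4, curvature g p (basisVec i) X Y i

/-- The scalar curvature `τ = tr_g ρ`. -/
def scalarCurvature (g : BilinField) (p : Coord 4) : ℝ :=
  ∑ i : Fin 4, ∑ j : Fin 4, invMetric g p i j * ricci g p (basisVec i) (basisVec j)

/-- The derivation `(R(X,Y)·R)(Z,W)V`. -/
def curvatureDerivation (g : BilinField) (p X Y Z W V : Coord 4) : Coord 4 :=
  curvature g p X Y (curvature g p Z W V) - curvature g p (curvature g p X Y Z) W V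
    - curvature g p Z (curvature g p X Y W) V - curvature g p Z W (curvature g p X Y V)

/-- `(M,g)` is semi-symmetric: `R·R = 0`. -/
def IsSemiSymmetric (M : Set (Coord 4)) (g : BilinField) : Prop :=
  ∀ p ∈ M, ∀ X Y Z W V, curvatureDerivation g p X Y Z W V = 0

/-- The squared norm `|θ|²` of a 1-form. -/
def normSqForm (g : BilinField) (θ : OneForm) (p : Coord 4) : ℝ :=
  ∑ i : Fin 4, ∑ j : Fin 4, invMetric g p i j * θ p (basisVec i) * θ p (basisVec j)

/-- `(∇_X θ)(Y) = X(θ(Y)) - θ(∇_X Y)` for a 1-form `θ`. -/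
def nablaForm (g : BilinField) (θ : OneForm) (p X Y : Coord 4) : ℝ :=
  dirDeriv (fun q => θ q Y) p X - θ p (leviCivita g (fun _ => X) (fun _ => Y) p)

/-- The codifferential `δθ = - tr_g ∇θ` of a 1-form. -/
def codifferential (g : BilinField) (θ : OneForm) (p : Coord 4) : ℝ :=
  -∑ i : Fin 4, ∑ j : Fin 4, invMetric g p i j * nablaForm g θ p (basisVec i) (basisVec j)

/-- `α ∧ β` for 1-forms: `(α ∧ β)(X,Y) = α(X)β(Y) - α(Y)β(X)`. -/
def wedge (a b : Coord 4 →ₗ[ℝ] ℝ) : Coord 4 →ₗ[ℝ] Coord 4 →ₗ[ℝ] ℝ :=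
  a.smulRight b - b.smulRight a

/-- The exterior derivative of a 2-form,
`dσ(X,Y,Z) = X(σ(Y,Z)) + Y(σ(Z,X)) + Z(σ(X,Y))` for constant fields `X, Y, Z`. -/
def extDerivTwo (σ : BilinField) (p X Y Z : Coord 4) : ℝ :=
  dirDeriv (fun q => σ q Y Z) p X + dirDeriv (fun q => σ q Z X) p Y
    + dirDeriv (fun q => σ q X Y) p Z

/-- `(θ ∧ σ)(X,Y,Z)` for a 1-form `θ` and a 2-form `σ`. -/
def wedgeOneTwo (θ : OneForm) (σ : BilinField) (p X Y Z : Coord 4) : ℝ :=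
  θ p X * σ p Y Z + θ p Y * σ p Z X + θ p Z * σ p X Y

/-- The Nijenhuis tensor `N^J(X,Y) = [JX,JY] - J[JX,Y] - J[X,JY] - [X,Y]`
on constant fields `X, Y` (so that `[X,Y] = 0`; the term is kept for readability). -/
def nijenhuis (J : EndField) (p X Y : Coord 4) : Coord 4 :=
  VectorField.lieBracket ℝ (fun q => J q X) (fun q => J q Y) p
    - J p (VectorField.lieBracket ℝ (fun q => J q X) (fun _ => Y) p)
    - J p (VectorField.lieBracket ℝ (fun _ => X) (fun q => J q Y) p)
    - VectorField.lieBracket ℝ (fun _ => X) (fun _ => Y) p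

/-- The Kähler form `Ω(X,Y) = g(JX,Y)`. -/
def kahlerForm (g : BilinField) (J : EndField) : BilinField := fun p => (g p).comp (J p)

/-- `(M,g,J)` is a Hermitian manifold: `J` is a smooth `g`-orthogonal almost complex structure
with vanishing Nijenhuis tensor. -/
structure IsHermitian (M : Set (Coord 4)) (g : BilinField) (J : EndField) : Prop where
  metric : IsRiemannianMetric M g
  smooth : ∀ X : Coord 4, ContDiffOn ℝ ∞ (fun p => J p X) M
  sq : ∀ p ∈ M, ∀ X, J p (J p X) = -X
  orthogonal : ∀ p ∈ M, ∀ X Y, g p (J p X) (J p Y) = g p X Y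
  integrable : ∀ p ∈ M, ∀ X Y, nijenhuis J p X Y = 0

/-- `(M,g,J)` is a Kähler manifold: Hermitian with closed Kähler form. -/
structure IsKahler (M : Set (Coord 4)) (g : BilinField) (J : EndField) : Prop where
  hermitian : IsHermitian M g J
  closed : ∀ p ∈ M, ∀ X Y Z, extDerivTwo (kahlerForm g J) p X Y Z = 0

/-- `(M,g,J)` is locally conformally Kähler: it is Hermitian, and near every point of `M` there
is a conformal metric `e^u g` which is Kähler with respect to `J`. -/
def IsLocallyConformallyKahler (M : Set (Coord 4)) (g : BilinField) (J : EndField) : Prop :=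
  IsHermitian M g J ∧ ∀ p ∈ M, ∃ V : Set (Coord 4), IsOpen V ∧ p ∈ V ∧ V ⊆ M ∧
    ∃ u : Coord 4 → ℝ, ContDiffOn ℝ ∞ u V ∧ IsKahler V (fun q => Real.exp (u q) • g q) J

/-- `θ` is the Lee form of `(M,g,J)`: `dΩ = 2 θ ∧ Ω`. -/
def IsLeeForm (M : Set (Coord 4)) (g : BilinField) (J : EndField) (θ : OneForm) : Prop :=
  ∀ p ∈ M, ∀ X Y Z, extDerivTwo (kahlerForm g J) p X Y Z =
    2 * wedgeOneTwo θ (kahlerForm g J) p X Y Z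

/-- The conformal scalar curvature `κ = τ - 6(|θ|² + δθ)` of a Hermitian surface with Lee
form `θ`. -/
def conformalScalarCurvature (g : BilinField) (θ : OneForm) (p : Coord 4) : ℝ :=
  scalarCurvature g p - 6 * (normSqForm g θ p + codifferential g θ p)

/-- The Ricci tensor is `J`-invariant: `ρ(JX,JY) = ρ(X,Y)`. -/
def HasInvariantRicci (M : Set (Coord 4)) (g : BilinField) (J : EndField) : Prop :=
  ∀ p ∈ M, ∀ X Y, ricci g p (J p X) (J p Y) = ricci g p X Y

/-- The first Gray condition `R(JX,JY,Z,W) = R(X,Y,Z,W)`. -/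
def SatisfiesG1 (M : Set (Coord 4)) (g : BilinField) (J : EndField) : Prop :=
  ∀ p ∈ M, ∀ X Y Z W, curvature4 g p (J p X) (J p Y) Z W = curvature4 g p X Y Z W

/-- The 2-form `σ` is anti-self-dual for `g` and the orientation induced by `J`: in each
orthonormal frame `(X, JX, Y, JY)`, which is positively oriented, `σ₁₂ = -σ₃₄`, `σ₁₃ = σ₂₄` and
`σ₁₄ = -σ₂₃`. -/
def IsAntiSelfDual (M : Set (Coord 4)) (g : BilinField) (J : EndField) (σ : BilinField) : Prop :=
  ∀ p ∈ M, ∀ X Y, g p X X = 1 → g p Y Y = 1 → g p X Y = 0 → g p (J p X) Y = 0 →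
    σ p X (J p X) = -σ p Y (J p Y) ∧ σ p X Y = σ p (J p X) (J p Y) ∧
      σ p X (J p Y) = -σ p (J p X) Y

/-- `Jbar` is an opposite Hermitian structure of `(M,g,J)`: both are Hermitian, and the Kähler
form of `Jbar` is anti-self-dual for the orientation of `J`. -/
def IsOppositeHermitian (M : Set (Coord 4)) (g : BilinField) (J Jbar : EndField) : Prop :=
  IsHermitian M g J ∧ IsHermitian M g Jbar ∧ IsAntiSelfDual M g J (kahlerForm g Jbar)

/-- `(∇_X J)Y = ∇_X(JY) - J(∇_X Y)`. -/
def nablaEnd (g : BilinField) (J : EndField) (p X Y : Coord 4) : Coord 4 :=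
  leviCivita g (fun _ => X) (fun q => J q Y) p - J p (leviCivita g (fun _ => X) (fun _ => Y) p)

/-- The nullity distribution `𝒟 = {X : ∇_X J = 0}` of `(M,g,J)`. -/
def nullityDistribution (g : BilinField) (J : EndField) (p : Coord 4) : Set (Coord 4) :=
  {X | ∀ Y, nablaEnd g J p X Y = 0}

/-- `Jbar` is the almost Hermitian structure opposite to `J` which is defined by the
distribution `D`: `Jbar = -J` on `D` and `Jbar = J` on the orthogonal complement of `D`. -/
def IsOppositeAlong (M : Set (Coord 4)) (g : BilinField) (J Jbar : EndField)
    (D : Coord 4 → Set (Coord 4)) : Prop :=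
  ∀ p ∈ M, (∀ X ∈ D p, Jbar p X = -J p X) ∧
    ∀ X, (∀ Y ∈ D p, g p X Y = 0) → Jbar p X = J p X

/-- `D` is a smooth distribution of rank two on `M`. -/
def IsSmoothRankTwo (M : Set (Coord 4)) (D : Coord 4 → Set (Coord 4)) : Prop :=
  ∀ p ∈ M, ∃ V : Set (Coord 4), IsOpen V ∧ p ∈ V ∧ V ⊆ M ∧ ∃ A B : VecField,
    ContDiffOn ℝ ∞ A V ∧ ContDiffOn ℝ ∞ B V ∧
      ∀ q ∈ V, LinearIndependent ℝ ![A q, B q] ∧ D q = Submodule.span ℝ {A q, B q}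

/-- `(M,g,J)` is a QCH Kähler surface with respect to the two-dimensional `J`-invariant
distribution `D`: the holomorphic curvature `R(X,JX,JX,X)` of a unit vector `X` depends only on
the point and on the norm of the orthogonal projection `X'` of `X` onto `D`. -/
structure IsQCH (M : Set (Coord 4)) (g : BilinField) (J : EndField)
    (D : Coord 4 → Set (Coord 4)) : Prop where
  kahler : IsKahler M g J
  rankTwo : IsSmoothRankTwo M D
  invariant : ∀ p ∈ M, ∀ X ∈ D p, J p X ∈ D p
  curvature : ∃ φ : Coord 4 → ℝ → ℝ, ∀ p ∈ M, ∀ X X' : Coord 4, g p X X = 1 →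
    X' ∈ D p → (∀ Y ∈ D p, g p (X - X') Y = 0) →
      curvature4 g p X (J p X) (J p X) X = φ p (Real.sqrt (g p X' X'))

/-! ## The explicit metric

The coordinates on `M` are `(x,y,z,t) = (p 0, p 1, p 2, p 3)`. -/

/-- The flat Laplacian `f_xx + f_yy` on the plane. -/
def laplacianPlane (f : Coord 2 → ℝ) (q : Coord 2) : ℝ :=
  partialDeriv 0 (partialDeriv 0 f) q + partialDeriv 1 (partialDeriv 1 f) q

/-- The function `ln f`. -/
def logFun (f : Coord 2 → ℝ) : Coord 2 → ℝ := fun q => Real.log (f q)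

/-- The projection `(x,y,z,t) ↦ (x,y)`. -/
def baseProj (p : Coord 4) : Coord 2 := ![p 0, p 1]

/-- `M = U × {(z,t) : z < 0}`. -/
def totalSpace (U : Set (Coord 2)) : Set (Coord 4) := {p | baseProj p ∈ U ∧ p 2 < 0}

/-- The coordinate 1-forms `dx, dy, dz, dt` are `dCoord 0, …, dCoord 3`. -/
def dCoord (i : Fin 4) : Coord 4 →ₗ[ℝ] ℝ := LinearMap.proj i

/-- `l₂ = -(ln H)_y`. -/
def lTwo (H : Coord 2 → ℝ) (q : Coord 2) : ℝ := -partialDeriv 1 (logFun H) q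

/-- `n₂ = (ln H)_x`. -/
def nTwo (H : Coord 2 → ℝ) (q : Coord 2) : ℝ := partialDeriv 0 (logFun H) q

/-- `θ₃ = -(z/2) dt + (cos(t/2) H + z l₂) dx + (-sin(t/2) H + z n₂) dy`. -/
def thetaThree (H : Coord 2 → ℝ) : OneForm := fun p =>
  (-(p 2 / 2)) • dCoord 3
    + (Real.cos (p 3 / 2) * H (baseProj p) + p 2 * lTwo H (baseProj p)) • dCoord 0
    + (-Real.sin (p 3 / 2) * H (baseProj p) + p 2 * nTwo H (baseProj p)) • dCoord 1

/-- `θ₄ = dz - sin(t/2) H dx - cos(t/2) H dy`. -/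
def thetaFour (H : Coord 2 → ℝ) : OneForm := fun p =>
  dCoord 2 - (Real.sin (p 3 / 2) * H (baseProj p)) • dCoord 0
    - (Real.cos (p 3 / 2) * H (baseProj p)) • dCoord 1

/-- `g = z² h² (dx² + dy²) + θ₃² + θ₄²`. -/
def metricG (h H : Coord 2 → ℝ) : BilinField := fun p =>
  ((p 2) ^ 2 * (h (baseProj p)) ^ 2) •
      ((dCoord 0).smulRight (dCoord 0) + (dCoord 1).smulRight (dCoord 1))
    + (thetaThree H p).smulRight (thetaThree H p) + (thetaFour H p).smulRight (thetaFour H p)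

/-- `z² ω_Σ = z² h² dx ∧ dy`. -/
def areaForm (h : Coord 2 → ℝ) : BilinField := fun p =>
  ((p 2) ^ 2 * (h (baseProj p)) ^ 2) • wedge (dCoord 0) (dCoord 1)

/-- `α = -2/z`. -/
def alphaFun (p : Coord 4) : ℝ := -2 / p 2

end

noncomputable section

/-! ### Directional derivatives -/

/-! The method is Cartan's moving frame. In the orthonormal coframe `(z h dx, z h dy, θ₃, θ₄)` the
connection forms can be written down explicitly (`connection`). The equation `Δ ln H = 2h²` enters
at two places: it gives the `dx ∧ dy` part of `dθ₃`, and it gives the exterior derivative `-2h² dx ∧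
dy` of the fibre connection `½ dt - l₂ dx - n₂ dy`.

The second fact makes the curvature form of the fibre planes vanish. The mixed curvature forms
vanish as well, so the only one left is `Ω⁰₁ = -(Δ ln h + 4h²) dx ∧ dy`
(`curvatureForm_connection`). The whole curvature tensor is thus one function times the square of
the horizontal area form. Ricci, scalar and holomorphic curvature, `R·R = 0` and the first Gray
condition are then algebra in the horizontal plane.

Both complex structures have constant matrices in the frame: `E₀ ↦ E₁`, `E₂ ↦ s E₃` with `s = 1` for
`J` and `s = -1` for `J̄`. So `∇J` is the commutator of the connection matrix with a constant
matrix, and it carries a factor `1 + s` (`apply_nablaEnd`). It vanishes for `J̄`. For `J` its kernel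
in the direction slot is `dx = dy = 0`, which is the nullity distribution, and integrability follows
from `(∇_{JX}J)Y = J(∇_X J)Y`. Likewise `dΩ` carries a factor `1 + s`, which gives the Kähler
property and the Lee form together.

The Lee form `(2/z) θ₄` is not closed, whereas a conformal Kähler metric `e^u g` would force it to
equal `-½ du`. Finally `κ = τ` because `|θ|² = 4/z²` and `δθ = -4/z²` cancel.

The general part proves, for an arbitrary orthonormal coframe, that the coordinate definitions by
Christoffel symbols agree with Cartan's structure equations. -/

theorem vec_eq_sum_basisVec (X : Coord 4) : X = ∑ i, X i • basisVec i := by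
  ext k
  simp [basisVec, Finset.sum_apply, Pi.single_apply]

theorem oneForm_apply_eq_sum (α : Coord 4 →ₗ[ℝ] ℝ) (X : Coord 4) :
    α X = ∑ i, X i * α (basisVec i) := by
  conv_lhs => rw [vec_eq_sum_basisVec X]
  simp

theorem dirDeriv_eq_sum (f : Coord 4 → ℝ) (p X : Coord 4) :
    dirDeriv f p X = ∑ i, X i * dirDeriv f p (basisVec i) := by
  unfold dirDeriv
  conv_lhs => rw [vec_eq_sum_basisVec X]
  simp

/-- Product rule for the pairing of a 1-form with a vector field; in the first term the field is
frozen at its value at `p`. -/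
theorem hasFDerivAt_oneForm_apply {α : OneForm} {Y : VecField} {p : Coord 4}
    (hα : ∀ X, DifferentiableAt ℝ (fun q => α q X) p) (hY : DifferentiableAt ℝ Y p) :
    DifferentiableAt ℝ (fun q => α q (Y q)) p ∧ ∀ X,
    dirDeriv (fun q => α q (Y q)) p X =
      dirDeriv (fun q => α q (Y p)) p X + α p (fderiv ℝ Y p X) := by
  have hYi : ∀ i, HasFDerivAt (fun q => Y q i)
      ((ContinuousLinearMap.proj i).comp (fderiv ℝ Y p)) p := fun i =>
    (hasFDerivAt_pi'.1 hY.hasFDerivAt i)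
  have h1 := HasFDerivAt.fun_sum fun i (_ : i ∈ (Finset.univ : Finset (Fin 4))) =>
    (hYi i).fun_mul (hα (basisVec i)).hasFDerivAt
  simp only [← oneForm_apply_eq_sum] at h1
  have h2 := HasFDerivAt.fun_sum fun i (_ : i ∈ (Finset.univ : Finset (Fin 4))) =>
    (hα (basisVec i)).hasFDerivAt.const_mul (Y p i)
  simp only [← oneForm_apply_eq_sum] at h2
  refine ⟨h1.differentiableAt, fun X => ?_⟩
  unfold dirDeriv
  rw [h1.fderiv, h2.fderiv, oneForm_apply_eq_sum (α p)]
  simp [Finset.sum_add_distrib, mul_comm]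

theorem dirDeriv_oneForm_eq_sum {α : OneForm} {p : Coord 4}
    (hα : ∀ X, DifferentiableAt ℝ (fun q => α q X) p) (X Y : Coord 4) :
    dirDeriv (fun q => α q Y) p X = ∑ j, Y j * dirDeriv (fun q => α q (basisVec j)) p X := by
  have h2 := HasFDerivAt.fun_sum fun i (_ : i ∈ (Finset.univ : Finset (Fin 4))) =>
    (hα (basisVec i)).hasFDerivAt.const_mul (Y i)
  simp only [← oneForm_apply_eq_sum] at h2
  unfold dirDeriv
  rw [h2.fderiv]
  simp

theorem dirDeriv_congr {f f' : Coord 4 → ℝ} {M : Set (Coord 4)} (hM : IsOpen M)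
    {p : Coord 4} (hp : p ∈ M) (hf : ∀ q ∈ M, f q = f' q) (X : Coord 4) :
    dirDeriv f p X = dirDeriv f' p X := by
  unfold dirDeriv
  rw [Filter.EventuallyEq.fderiv_eq]
  filter_upwards [hM.mem_nhds hp] with q hq using hf q hq

/-- Symmetry of second derivatives. -/
theorem dirDeriv_dirDeriv_comm {f : Coord 4 → ℝ} {p : Coord 4} (hf : ContDiffAt ℝ ∞ f p)
    (X Y : Coord 4) :
    dirDeriv (fun q => dirDeriv f q Y) p X = dirDeriv (fun q => dirDeriv f q X) p Y := by
  have hs : IsSymmSndFDerivAt ℝ f p := hf.isSymmSndFDerivAt (by simp; norm_cast)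
  have hd : DifferentiableAt ℝ (fderiv ℝ f) p :=
    (hf.fderiv_right (m := 1) (by norm_cast)).differentiableAt (by simp)
  have key : ∀ Z W, dirDeriv (fun q => dirDeriv f q Z) p W = fderiv ℝ (fderiv ℝ f) p W Z := by
    intro Z W
    unfold dirDeriv
    rw [fderiv_clm_apply hd (differentiableAt_const _)]
    simp
  rw [key, key, hs.eq]

theorem dirDeriv_differentiableAt {f : Coord 4 → ℝ} {p : Coord 4} (hf : ContDiffAt ℝ ∞ f p)
    (X : Coord 4) : DifferentiableAt ℝ (fun q => dirDeriv f q X) p := by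
  have hd : DifferentiableAt ℝ (fderiv ℝ f) p :=
    (hf.fderiv_right (m := 1) (by norm_cast)).differentiableAt (by simp)
  exact hd.clm_apply (differentiableAt_const _)

theorem dirDeriv_mul {f f' : Coord 4 → ℝ} {p : Coord 4} (hf : DifferentiableAt ℝ f p)
    (hf' : DifferentiableAt ℝ f' p) (X : Coord 4) :
    dirDeriv (fun q => f q * f' q) p X = dirDeriv f p X * f' p + f p * dirDeriv f' p X := by
  unfold dirDeriv
  rw [fderiv_fun_mul hf hf']
  simp; ring

theorem dirDeriv_add {f f' : Coord 4 → ℝ} {p : Coord 4} (hf : DifferentiableAt ℝ f p)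
    (hf' : DifferentiableAt ℝ f' p) (X : Coord 4) :
    dirDeriv (fun q => f q + f' q) p X = dirDeriv f p X + dirDeriv f' p X := by
  unfold dirDeriv
  rw [fderiv_fun_add hf hf']
  simp

theorem dirDeriv_sub {f f' : Coord 4 → ℝ} {p : Coord 4} (hf : DifferentiableAt ℝ f p)
    (hf' : DifferentiableAt ℝ f' p) (X : Coord 4) :
    dirDeriv (fun q => f q - f' q) p X = dirDeriv f p X - dirDeriv f' p X := by
  unfold dirDeriv
  rw [fderiv_fun_sub hf hf']
  simp

theorem dirDeriv_sum {f : Fin 4 → Coord 4 → ℝ} {p : Coord 4}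
    (hf : ∀ i, DifferentiableAt ℝ (f i) p) (X : Coord 4) :
    dirDeriv (fun q => ∑ i, f i q) p X = ∑ i, dirDeriv (f i) p X := by
  unfold dirDeriv
  rw [fderiv_fun_sum fun i _ => hf i]
  simp

theorem dirDeriv_const_mul {f : Coord 4 → ℝ} {p : Coord 4} (hf : DifferentiableAt ℝ f p)
    (c : ℝ) (X : Coord 4) :
    dirDeriv (fun q => c * f q) p X = c * dirDeriv f p X := by
  unfold dirDeriv
  rw [fderiv_const_mul hf]
  simp

/-! ### Orthonormal coframes and connection forms -/

/-- `e` is a smooth `g`-orthonormal coframe on the open set `M`, with dual frame `E`. -/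
structure IsOrthonormalCoframe (M : Set (Coord 4)) (g : BilinField) (e : Fin 4 → OneForm)
    (E : Fin 4 → VecField) : Prop where
  isOpen : IsOpen M
  smooth : ∀ a X, ContDiffOn ℝ ∞ (fun p => e a p X) M
  smooth_dual : ∀ a, ContDiffOn ℝ ∞ (E a) M
  metric : ∀ p ∈ M, ∀ X Y, g p X Y = ∑ a, e a p X * e a p Y
  dual : ∀ p ∈ M, ∀ a b, e a p (E b p) = if a = b then 1 else 0
  expand : ∀ p ∈ M, ∀ X, X = ∑ a, e a p X • E a p

/-- `η` are the connection forms of the coframe `e`: they are skew and satisfy the first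
structure equation `deᵃ = -∑ᵦ ηᵃᵦ ∧ eᵇ`. -/
structure IsConnectionForm (M : Set (Coord 4)) (e : Fin 4 → OneForm)
    (η : Fin 4 → Fin 4 → OneForm) : Prop where
  smooth : ∀ a b X, ContDiffOn ℝ ∞ (fun p => η a b p X) M
  skew : ∀ p ∈ M, ∀ a b X, η a b p X = -η b a p X
  structureEq : ∀ p ∈ M, ∀ a X Y,
    dirDeriv (fun q => e a q Y) p X - dirDeriv (fun q => e a q X) p Y =
      -∑ b, (η a b p X * e b p Y - η a b p Y * e b p X)

/-- The curvature forms `Ωᵃᵦ = dηᵃᵦ + ∑ ηᵃ꜀ ∧ ηᶜᵦ`. -/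
def curvatureForm (η : Fin 4 → Fin 4 → OneForm) (a b : Fin 4) (p X Y : Coord 4) :
    ℝ :=
  dirDeriv (fun q => η a b q Y) p X - dirDeriv (fun q => η a b q X) p Y +
    ∑ c, (η a c p X * η c b p Y - η a c p Y * η c b p X)

/-! ### Levi-Civita connection and curvature from the structure equations -/

namespace IsOrthonormalCoframe

variable {M : Set (Coord 4)} {g : BilinField} {e : Fin 4 → OneForm} {E : Fin 4 → VecField}
  {η : Fin 4 → Fin 4 → OneForm} {p : Coord 4}

theorem contDiffAt (he : IsOrthonormalCoframe M g e E) (hp : p ∈ M) (a : Fin 4) (X : Coord 4) :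
    ContDiffAt ℝ ∞ (fun q => e a q X) p :=
  (he.smooth a X).contDiffAt (he.isOpen.mem_nhds hp)

theorem differentiableAt (he : IsOrthonormalCoframe M g e E) (hp : p ∈ M) (a : Fin 4)
    (X : Coord 4) : DifferentiableAt ℝ (fun q => e a q X) p :=
  (he.contDiffAt hp a X).differentiableAt (by simp)

theorem dual_differentiableAt (he : IsOrthonormalCoframe M g e E) (hp : p ∈ M) (a : Fin 4) :
    DifferentiableAt ℝ (E a) p :=
  ((he.smooth_dual a).contDiffAt (he.isOpen.mem_nhds hp)).differentiableAt (by simp)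

theorem ext (he : IsOrthonormalCoframe M g e E) (hp : p ∈ M) {X Y : Coord 4}
    (h : ∀ a, e a p X = e a p Y) : X = Y := by
  rw [he.expand p hp X, he.expand p hp Y]
  simp [h]

theorem apply_sum (he : IsOrthonormalCoframe M g e E) (hp : p ∈ M) (c : Fin 4 → ℝ) (a : Fin 4) :
    e a p (∑ b, c b • E b p) = c a := by
  simp [he.dual p hp]

theorem isRiemannianMetric (he : IsOrthonormalCoframe M g e E) : IsRiemannianMetric M g where
  smooth X Y := by
    refine ContDiffOn.congr (f := fun p => ∑ a, e a p X * e a p Y) ?_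
      fun p hp => he.metric p hp X Y
    exact ContDiffOn.sum fun a _ => (he.smooth a X).mul (he.smooth a Y)
  symm p hp X Y := by
    rw [he.metric p hp, he.metric p hp]
    exact Finset.sum_congr rfl fun a _ => mul_comm _ _
  pos p hp X hX := by
    rw [he.metric p hp]
    refine lt_of_le_of_ne (Finset.sum_nonneg fun a _ => mul_self_nonneg _) fun h => hX ?_
    have h0 := (Finset.sum_eq_zero_iff_of_nonneg fun a _ => mul_self_nonneg (e a p X)).1 h.symm
    refine he.ext hp fun a => ?_
    simpa using h0 a (Finset.mem_univ a)

/-- The Gram matrix is `∑ eᵃ ⊗ eᵃ`, and duality together with completeness of the frame makes `∑ E_a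
⊗ E_a` its inverse. -/
theorem invMetric_eq (he : IsOrthonormalCoframe M g e E) (hp : p ∈ M) (i j : Fin 4) :
    invMetric g p i j = ∑ a, E a p i * E a p j := by
  have : gramMatrix g p * Matrix.of (fun i j => ∑ a, E a p i * E a p j) = 1 := by
    ext i j
    have h1 : ∀ a, ∑ k, E a p k * g p (basisVec i) (basisVec k) = e a p (basisVec i) := by
      intro a
      rw [← oneForm_apply_eq_sum, he.metric p hp]
      simp [he.dual p hp]
    have h2 : (∑ a, e a p (basisVec i) • E a p) j = basisVec i j := by
      rw [← he.expand p hp]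
    simp only [Matrix.mul_apply, gramMatrix, Matrix.of_apply, Finset.mul_sum]
    rw [Finset.sum_comm]
    have h3 : ∀ a, ∑ k, g p (basisVec i) (basisVec k) * (E a p k * E a p j) =
        e a p (basisVec i) * E a p j := by
      intro a
      rw [← h1 a, Finset.sum_mul]
      exact Finset.sum_congr rfl fun k _ => by ring
    simp only [h3]
    simp only [Finset.sum_apply, Pi.smul_apply, smul_eq_mul] at h2
    rw [h2]
    simp [basisVec, Matrix.one_apply, Pi.single_apply, eq_comm]
  unfold invMetric
  rw [Matrix.inv_eq_right_inv this]
  rfl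

theorem dirDeriv_metric (he : IsOrthonormalCoframe M g e E) (hp : p ∈ M) (X Y Z : Coord 4) :
    dirDeriv (fun q => g q Y Z) p X = ∑ a, (dirDeriv (fun q => e a q Y) p X * e a p Z +
      e a p Y * dirDeriv (fun q => e a q Z) p X) := by
  rw [dirDeriv_congr he.isOpen hp (fun q hq => he.metric q hq Y Z),
    dirDeriv_sum fun a => (he.differentiableAt hp a Y).fun_mul (he.differentiableAt hp a Z)]
  exact Finset.sum_congr rfl fun a _ =>
    dirDeriv_mul (he.differentiableAt hp a Y) (he.differentiableAt hp a Z) X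

/-- The Koszul formula. -/
theorem koszul (he : IsOrthonormalCoframe M g e E) (hη : IsConnectionForm M e η) (hp : p ∈ M)
    (X Y Z : Coord 4) :
    dirDeriv (fun q => g q Y Z) p X + dirDeriv (fun q => g q X Z) p Y
        - dirDeriv (fun q => g q X Y) p Z =
      2 * ∑ a, (dirDeriv (fun q => e a q Y) p X + ∑ b, η a b p X * e b p Y) * e a p Z := by
  -- Metric compatibility: a skew connection matrix contributes nothing to an expression symmetric
  -- in the two coframe arguments.
  have hsk : ∀ A B C : Coord 4, ∑ a, ((∑ b, η a b p A * e b p B) * e a p C +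
      (∑ b, η a b p A * e b p C) * e a p B) = 0 := by
    intro A B C
    simp only [Finset.sum_add_distrib, Finset.sum_mul]
    conv_lhs => rw [Finset.sum_comm]
    rw [← Finset.sum_add_distrib]
    refine Finset.sum_eq_zero fun a _ => ?_
    rw [← Finset.sum_add_distrib]
    refine Finset.sum_eq_zero fun b _ => ?_
    rw [hη.skew p hp a b]; ring
  rw [he.dirDeriv_metric hp, he.dirDeriv_metric hp, he.dirDeriv_metric hp]
  have h1 := hsk X Y Z
  have h2 := hsk Y X Z
  have h3 := hsk Z X Y
  have s1 := fun a => hη.structureEq p hp a X Y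
  have s2 := fun a => hη.structureEq p hp a X Z
  have s3 := fun a => hη.structureEq p hp a Y Z
  simp only [Finset.sum_sub_distrib] at s1 s2 s3
  have key : ∑ a, (dirDeriv (fun q => e a q Y) p X * e a p Z +
      e a p Y * dirDeriv (fun q => e a q Z) p X) + ∑ a, (dirDeriv (fun q => e a q X) p Y * e a p Z
      + e a p X * dirDeriv (fun q => e a q Z) p Y) - ∑ a, (dirDeriv (fun q => e a q X) p Z *
      e a p Y + e a p X * dirDeriv (fun q => e a q Y) p Z) -
      2 * ∑ a, (dirDeriv (fun q => e a q Y) p X + ∑ b, η a b p X * e b p Y) * e a p Z =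
      - ∑ a, ((∑ b, η a b p X * e b p Y) * e a p Z + (∑ b, η a b p X * e b p Z) * e a p Y)
      - ∑ a, ((∑ b, η a b p Y * e b p X) * e a p Z + (∑ b, η a b p Y * e b p Z) * e a p X)
      + ∑ a, ((∑ b, η a b p Z * e b p X) * e a p Y + (∑ b, η a b p Z * e b p Y) * e a p X) := by
    rw [Finset.mul_sum, ← Finset.sum_add_distrib, ← Finset.sum_sub_distrib,
      ← Finset.sum_sub_distrib, ← Finset.sum_neg_distrib, ← Finset.sum_sub_distrib,
      ← Finset.sum_add_distrib]
    refine Finset.sum_congr rfl fun a _ => ?_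
    -- The structure equations trade the antisymmetrised derivatives of `eᵃ` for connection terms;
    -- what remains is the three sums killed by `hsk`.
    linear_combination -e a p Z * s1 a + e a p Y * s2 a + e a p X * s3 a
  rw [h1, h2, h3] at key
  linear_combination key

/-- The bracket in the Christoffel symbol is the Koszul expression on coordinate vectors;
contracting it with `∑ E_c ⊗ E_c` raises the index. -/
theorem christoffel_eq (he : IsOrthonormalCoframe M g e E) (hη : IsConnectionForm M e η)
    (hp : p ∈ M) (i j k : Fin 4) :
    christoffel g p i j k = ∑ a, (dirDeriv (fun q => e a q (basisVec j)) p (basisVec i) +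
      ∑ b, η a b p (basisVec i) * e b p (basisVec j)) * E a p k := by
  unfold christoffel
  have h : ∀ l, partialDeriv i (fun q => gramMatrix g q j l) p
      + partialDeriv j (fun q => gramMatrix g q i l) p
      - partialDeriv l (fun q => gramMatrix g q i j) p = _ := fun l =>
    he.koszul hη hp (basisVec i) (basisVec j) (basisVec l)
  simp only [h, he.invMetric_eq hp]
  set N : Fin 4 → ℝ := fun a => dirDeriv (fun q => e a q (basisVec j)) p (basisVec i) +
      ∑ b, η a b p (basisVec i) * e b p (basisVec j) with hN
  change 1 / 2 * ∑ l, (∑ c, E c p k * E c p l) * (2 * ∑ a, N a * e a p (basisVec l)) =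
    ∑ a, N a * E a p k
  have hd : ∀ a c, ∑ l, E c p l * e a p (basisVec l) = if a = c then 1 else 0 := by
    intro a c
    rw [← oneForm_apply_eq_sum, he.dual p hp]
  calc 1 / 2 * ∑ l, (∑ c, E c p k * E c p l) * (2 * ∑ a, N a * e a p (basisVec l))
      = ∑ l, ∑ c, ∑ a, E c p k * N a * (E c p l * e a p (basisVec l)) := by
        rw [Finset.mul_sum]
        refine Finset.sum_congr rfl fun l _ => ?_
        rw [show ∀ A B : ℝ, 1 / 2 * (A * (2 * B)) = A * B by intro A B; ring, Finset.sum_mul_sum]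
        exact Finset.sum_congr rfl fun c _ => Finset.sum_congr rfl fun a _ => by ring
    _ = ∑ c, ∑ a, E c p k * N a * ∑ l, (E c p l * e a p (basisVec l)) := by
        rw [Finset.sum_comm]
        refine Finset.sum_congr rfl fun c _ => ?_
        rw [Finset.sum_comm]
        exact Finset.sum_congr rfl fun a _ => by rw [Finset.mul_sum]
    _ = ∑ a, N a * E a p k := by
        simp [hd, mul_comm]

/-- The Levi-Civita connection in terms of the coframe:
`eᵃ(∇_X Y) = X(eᵃ(Y)) + ∑ᵦ ηᵃᵦ(X) eᵇ(Y)`. -/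
theorem apply_leviCivita (he : IsOrthonormalCoframe M g e E) (hη : IsConnectionForm M e η)
    (hp : p ∈ M) (X Y : VecField) (hY : DifferentiableAt ℝ Y p) (a : Fin 4) :
    e a p (leviCivita g X Y p) =
      dirDeriv (fun q => e a q (Y q)) p (X p) + ∑ b, η a b p (X p) * e b p (Y p) := by
  have hΓ : (fun k => ∑ i : Fin 4, ∑ j : Fin 4, christoffel g p i j k * X p i * Y p j) =
      ∑ a, (dirDeriv (fun q => e a q (Y p)) p (X p) + ∑ b, η a b p (X p) * e b p (Y p)) •
        E a p := by
    have hlin : ∀ a, dirDeriv (fun q => e a q (Y p)) p (X p) + ∑ b, η a b p (X p) * e b p (Y p) =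
        ∑ i, ∑ j, X p i * Y p j * (dirDeriv (fun q => e a q (basisVec j)) p (basisVec i) +
          ∑ b, η a b p (basisVec i) * e b p (basisVec j)) := by
      intro a
      have h1 : dirDeriv (fun q => e a q (Y p)) p (X p) =
          ∑ i, ∑ j, X p i * Y p j * dirDeriv (fun q => e a q (basisVec j)) p (basisVec i) := by
        rw [dirDeriv_eq_sum]
        refine Finset.sum_congr rfl fun i _ => ?_
        rw [dirDeriv_oneForm_eq_sum (he.differentiableAt hp a), Finset.mul_sum]
        exact Finset.sum_congr rfl fun j _ => by ring
      have h2 : ∑ b, η a b p (X p) * e b p (Y p) =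
          ∑ i, ∑ j, ∑ b, X p i * Y p j * (η a b p (basisVec i) * e b p (basisVec j)) := by
        have : ∀ b, η a b p (X p) * e b p (Y p) =
            ∑ i, ∑ j, X p i * Y p j * (η a b p (basisVec i) * e b p (basisVec j)) := by
          intro b
          rw [oneForm_apply_eq_sum (η a b p) (X p), oneForm_apply_eq_sum (e b p) (Y p),
            Finset.sum_mul_sum]
          exact Finset.sum_congr rfl fun i _ => Finset.sum_congr rfl fun j _ => by ring
        simp only [this]
        rw [Finset.sum_comm]
        exact Finset.sum_congr rfl fun i _ => Finset.sum_comm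
      simp only [mul_add, Finset.sum_add_distrib, Finset.mul_sum]
      rw [h1, h2]
    ext k
    simp only [Finset.sum_apply, Pi.smul_apply, smul_eq_mul, hlin, he.christoffel_eq hη hp,
      Finset.sum_mul]
    conv_rhs => rw [Finset.sum_comm]
    refine Finset.sum_congr rfl fun i _ => ?_
    conv_rhs => rw [Finset.sum_comm]
    refine Finset.sum_congr rfl fun j _ => ?_
    exact Finset.sum_congr rfl fun a _ => by ring
  unfold leviCivita
  rw [hΓ, map_add, he.apply_sum hp,
    (hasFDerivAt_oneForm_apply (he.differentiableAt hp a) hY).2]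
  ring

theorem apply_leviCivita_const (he : IsOrthonormalCoframe M g e E) (hη : IsConnectionForm M e η)
    (hp : p ∈ M) (X : VecField) (Y : Coord 4) (a : Fin 4) :
    e a p (leviCivita g X (fun _ => Y) p) =
      dirDeriv (fun q => e a q Y) p (X p) + ∑ b, η a b p (X p) * e b p Y :=
  he.apply_leviCivita hη hp X _ (differentiableAt_const _) a

/-- Needed to apply the frame formula a second time, to `∇_Y Z` itself. -/
theorem leviCivita_differentiableAt (he : IsOrthonormalCoframe M g e E)
    (hη : IsConnectionForm M e η) (hp : p ∈ M) (X Y : Coord 4) :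
    DifferentiableAt ℝ (leviCivita g (fun _ => X) (fun _ => Y)) p := by
  have h : leviCivita g (fun _ => X) (fun _ => Y) =ᶠ[nhds p] fun q =>
      ∑ a, (dirDeriv (fun q => e a q Y) q X + ∑ b, η a b q X * e b q Y) • E a q := by
    filter_upwards [he.isOpen.mem_nhds hp] with q hq
    rw [he.expand q hq (leviCivita g (fun _ => X) (fun _ => Y) q)]
    simp only [he.apply_leviCivita_const hη hq]
  refine DifferentiableAt.congr_of_eventuallyEq ?_ h
  refine DifferentiableAt.fun_sum fun a _ => DifferentiableAt.fun_smul ?_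
    (he.dual_differentiableAt hp a)
  refine (dirDeriv_differentiableAt (he.contDiffAt hp a Y) X).fun_add ?_
  exact DifferentiableAt.fun_sum fun b _ =>
    (((hη.smooth a b X).contDiffAt (he.isOpen.mem_nhds hp)).differentiableAt (by simp)).fun_mul
      (he.differentiableAt hp b Y)

/-- The second structure equation. -/
theorem apply_curvature (he : IsOrthonormalCoframe M g e E) (hη : IsConnectionForm M e η)
    (hp : p ∈ M) (X Y Z : Coord 4) (a : Fin 4) :
    e a p (curvature g p X Y Z) = ∑ b, curvatureForm η a b p X Y * e b p Z := by
  have hηd : ∀ a b X, DifferentiableAt ℝ (fun q => η a b q X) p := fun a b X =>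
    ((hη.smooth a b X).contDiffAt (he.isOpen.mem_nhds hp)).differentiableAt (by simp)
  have second : ∀ X Y : Coord 4,
      e a p (leviCivita g (fun _ => X) (leviCivita g (fun _ => Y) (fun _ => Z)) p) =
      dirDeriv (fun q => dirDeriv (fun q => e a q Z) q Y) p X +
        ∑ b, (dirDeriv (fun q => η a b q Y) p X * e b p Z +
          η a b p Y * dirDeriv (fun q => e b q Z) p X) +
        ∑ b, η a b p X * (dirDeriv (fun q => e b q Z) p Y + ∑ c, η b c p Y * e c p Z) := by
    intro X Y
    rw [he.apply_leviCivita hη hp _ _ (he.leviCivita_differentiableAt hη hp Y Z)]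
    simp only [he.apply_leviCivita_const hη hp]
    congr 1
    -- The frame formula for `∇_Y Z` holds on all of the open set `M`, so it may be differentiated
    -- at `p`.
    rw [dirDeriv_congr he.isOpen hp
        (fun q hq => he.apply_leviCivita_const hη hq (fun _ => Y) Z a),
      dirDeriv_add (dirDeriv_differentiableAt (he.contDiffAt hp a Z) Y)
        (DifferentiableAt.fun_sum fun b _ => (hηd a b Y).fun_mul (he.differentiableAt hp b Z)),
      dirDeriv_sum fun b => (hηd a b Y).fun_mul (he.differentiableAt hp b Z)]
    congr 1
    exact Finset.sum_congr rfl fun b _ => dirDeriv_mul (hηd a b Y) (he.differentiableAt hp b Z) X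
  have hbr : leviCivita g (VectorField.lieBracket ℝ (fun _ => X) (fun _ => Y)) (fun _ => Z) p =
      0 := by
    refine he.ext hp fun a => ?_
    rw [he.apply_leviCivita_const hη hp]
    have : VectorField.lieBracket ℝ (fun _ : Coord 4 => X) (fun _ => Y) p = 0 := by
      simp [VectorField.lieBracket]
    simp [this, dirDeriv]
  unfold curvature curvatureField
  -- The second derivatives of `eᵃ(Z)` cancel by symmetry, as do the mixed terms, leaving `dη + η ∧
  -- η`.
  rw [hbr, sub_zero, map_sub, second X Y, second Y X,
    dirDeriv_dirDeriv_comm (he.contDiffAt hp a Z) X Y]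
  have hcc : ∀ X Y : Coord 4, ∑ b, η a b p X * ∑ c, η b c p Y * e c p Z =
      ∑ b, (∑ c, η a c p X * η c b p Y) * e b p Z := by
    intro X Y
    simp only [Finset.mul_sum, Finset.sum_mul]
    rw [Finset.sum_comm]
    exact Finset.sum_congr rfl fun _ _ => Finset.sum_congr rfl fun _ _ => by ring
  simp only [curvatureForm, mul_add, add_mul, sub_mul, Finset.sum_add_distrib, hcc,
    Finset.sum_sub_distrib]
  ring

/-- Torsion-freeness, which in the coframe is exactly the first structure equation. -/
theorem lieBracket_eq (he : IsOrthonormalCoframe M g e E) (hη : IsConnectionForm M e η)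
    (hp : p ∈ M) {X Y : VecField} (hX : DifferentiableAt ℝ X p) (hY : DifferentiableAt ℝ Y p) :
    VectorField.lieBracket ℝ X Y p = leviCivita g X Y p - leviCivita g Y X p := by
  refine he.ext hp fun a => ?_
  rw [map_sub, he.apply_leviCivita hη hp _ _ hY, he.apply_leviCivita hη hp _ _ hX,
    (hasFDerivAt_oneForm_apply (he.differentiableAt hp a) hY).2,
    (hasFDerivAt_oneForm_apply (he.differentiableAt hp a) hX).2]
  have := hη.structureEq p hp a (X p) (Y p)
  rw [Finset.sum_sub_distrib] at this
  simp only [VectorField.lieBracket, map_sub]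
  linear_combination -this

/-- The Nijenhuis tensor in terms of `∇J`. -/
theorem nijenhuis_eq (he : IsOrthonormalCoframe M g e E) (hη : IsConnectionForm M e η)
    (hp : p ∈ M) {J : EndField} (hJ : ∀ X, DifferentiableAt ℝ (fun q => J q X) p)
    (hsq : ∀ X, J p (J p X) = -X) (X Y : Coord 4) :
    nijenhuis J p X Y = nablaEnd g J p (J p X) Y - nablaEnd g J p (J p Y) X
      + J p (nablaEnd g J p Y X) - J p (nablaEnd g J p X Y) := by
  unfold nijenhuis
  have hc : ∀ Z : Coord 4, DifferentiableAt ℝ (fun _ : Coord 4 => Z) p := fun Z =>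
    differentiableAt_const _
  rw [he.lieBracket_eq hη hp (hJ X) (hJ Y), he.lieBracket_eq hη hp (hJ X) (hc Y),
    he.lieBracket_eq hη hp (hc X) (hJ Y), he.lieBracket_eq hη hp (hc X) (hc Y)]
  simp only [nablaEnd, map_sub, hsq]
  -- The connection depends only on the value at `p` of its direction argument.
  have h1 : ∀ Z W, leviCivita g (fun q => J q Z) W p = leviCivita g (fun _ => J p Z) W p :=
    fun Z W => rfl
  simp only [h1]
  abel

end IsOrthonormalCoframe

/-- The endomorphism field with the constant matrix `A` in the frame `E`. -/
def frameEnd (e : Fin 4 → OneForm) (E : Fin 4 → VecField)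
    (A : Matrix (Fin 4) (Fin 4) ℝ) : EndField := fun p =>
  ∑ a, (∑ b, A a b • e b p).smulRight (E a p)

/-! ### Endomorphism fields with constant matrix in the frame -/

namespace IsOrthonormalCoframe

variable {M : Set (Coord 4)} {g : BilinField} {e : Fin 4 → OneForm} {E : Fin 4 → VecField}
  {η : Fin 4 → Fin 4 → OneForm} {p : Coord 4}

theorem apply_frameEnd (he : IsOrthonormalCoframe M g e E) (hp : p ∈ M)
    (A : Matrix (Fin 4) (Fin 4) ℝ) (X : Coord 4) (a : Fin 4) :
    e a p (frameEnd e E A p X) = ∑ b, A a b * e b p X := by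
  have : frameEnd e E A p X = ∑ a, (∑ b, A a b * e b p X) • E a p := by
    simp [frameEnd, LinearMap.sum_apply]
  rw [this, he.apply_sum hp]

theorem frameEnd_contDiffOn (he : IsOrthonormalCoframe M g e E) (A : Matrix (Fin 4) (Fin 4) ℝ)
    (X : Coord 4) : ContDiffOn ℝ ∞ (fun p => frameEnd e E A p X) M := by
  have : (fun p => frameEnd e E A p X) = fun p => ∑ a, (∑ b, A a b * e b p X) • E a p := by
    ext1 p
    simp [frameEnd, LinearMap.sum_apply]
  rw [this]
  exact ContDiffOn.sum fun a _ => (ContDiffOn.sum fun b _ =>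
    contDiffOn_const.mul (he.smooth b X)).smul (he.smooth_dual a)

/-- Since `A` is constant, the derivatives of the coframe cancel and only the commutator `[η(X), A]`
survives. -/
theorem apply_nablaEnd_frameEnd (he : IsOrthonormalCoframe M g e E)
    (hη : IsConnectionForm M e η) (hp : p ∈ M) (A : Matrix (Fin 4) (Fin 4) ℝ) (X Y : Coord 4)
    (a : Fin 4) :
    e a p (nablaEnd g (frameEnd e E A) p X Y) =
      ∑ b, (∑ c, (η a c p X * A c b - A a c * η c b p X)) * e b p Y := by
  unfold nablaEnd
  have hd := ((he.frameEnd_contDiffOn A Y).contDiffAt (he.isOpen.mem_nhds hp)).differentiableAt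
    (by simp)
  rw [map_sub, he.apply_leviCivita hη hp _ _ hd,
    dirDeriv_congr he.isOpen hp (fun q hq => he.apply_frameEnd hq A Y a),
    dirDeriv_sum fun b => (he.differentiableAt hp b Y).const_mul _]
  simp only [dirDeriv_const_mul (he.differentiableAt hp _ Y), he.apply_frameEnd hp,
    he.apply_leviCivita_const hη hp]
  have h1 : ∑ b, (∑ c, η a c p X * A c b) * e b p Y =
      ∑ c, η a c p X * ∑ b, A c b * e b p Y := by
    simp only [Finset.mul_sum, Finset.sum_mul]
    rw [Finset.sum_comm]
    exact Finset.sum_congr rfl fun _ _ => Finset.sum_congr rfl fun _ _ => by ring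
  have h2 : ∑ b, (∑ c, A a c * η c b p X) * e b p Y =
      ∑ c, A a c * ∑ b, η c b p X * e b p Y := by
    simp only [Finset.mul_sum, Finset.sum_mul]
    rw [Finset.sum_comm]
    exact Finset.sum_congr rfl fun _ _ => Finset.sum_congr rfl fun _ _ => by ring
  simp only [Finset.sum_sub_distrib, sub_mul, mul_add, Finset.sum_add_distrib, h1, h2]
  ring

end IsOrthonormalCoframe

/-! ### The coframe of the metric -/

/-- The data from which the metric is built. -/
structure IsMetricData (U : Set (Coord 2)) (h H : Coord 2 → ℝ) : Prop where
  isOpen : IsOpen U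
  smooth_h : ContDiffOn ℝ ∞ h U
  smooth_H : ContDiffOn ℝ ∞ H U
  pos_h : ∀ q ∈ U, 0 < h q
  pos_H : ∀ q ∈ U, 0 < H q
  laplacian_eq : ∀ q ∈ U, laplacianPlane (logFun H) q = 2 * (h q) ^ 2

/-- The coframe `(z h dx, z h dy, θ₃, θ₄)`. -/
def coframe (h H : Coord 2 → ℝ) : Fin 4 → OneForm :=
  ![fun p => (p 2 * h (baseProj p)) • dCoord 0, fun p => (p 2 * h (baseProj p)) • dCoord 1,
    thetaThree H, thetaFour H]

/-- The frame dual to `coframe h H`. -/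
def dualFrame (h H : Coord 2 → ℝ) : Fin 4 → VecField :=
  ![fun p => (p 2 * h (baseProj p))⁻¹ • ![1, 0, Real.sin (p 3 / 2) * H (baseProj p),
      2 * (p 2)⁻¹ * (Real.cos (p 3 / 2) * H (baseProj p) + p 2 * lTwo H (baseProj p))],
    fun p => (p 2 * h (baseProj p))⁻¹ • ![0, 1, Real.cos (p 3 / 2) * H (baseProj p),
      2 * (p 2)⁻¹ * (-Real.sin (p 3 / 2) * H (baseProj p) + p 2 * nTwo H (baseProj p))],
    fun p => ![0, 0, 0, -(2 * (p 2)⁻¹)],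
    fun _ => ![0, 0, 1, 0]]

/-- The 1-form `½ dt - l₂ dx - n₂ dy`, the connection form of the distribution `dx = dy = 0`. -/
def fibreConnection (H : Coord 2 → ℝ) : OneForm := fun p =>
  (1 / 2 : ℝ) • dCoord 3 - lTwo H (baseProj p) • dCoord 0 - nTwo H (baseProj p) • dCoord 1

/-- The connection form of the horizontal planes. -/
def horizontalConnection (h H : Coord 2 → ℝ) : OneForm := fun p =>
  partialDeriv 1 (logFun h) (baseProj p) • dCoord 0
    - partialDeriv 0 (logFun h) (baseProj p) • dCoord 1 + fibreConnection H p

/-- The connection forms of `coframe h H`. -/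
def connection (h H : Coord 2 → ℝ) : Fin 4 → Fin 4 → OneForm :=
  ![![fun _ => 0, horizontalConnection h H, fun p => -(h (baseProj p) • dCoord 1),
      fun p => h (baseProj p) • dCoord 0],
    ![fun p => -horizontalConnection h H p, fun _ => 0, fun p => h (baseProj p) • dCoord 0,
      fun p => h (baseProj p) • dCoord 1],
    ![fun p => h (baseProj p) • dCoord 1, fun p => -(h (baseProj p) • dCoord 0), fun _ => 0,
      fun p => -fibreConnection H p],
    ![fun p => -(h (baseProj p) • dCoord 0), fun p => -(h (baseProj p) • dCoord 1),
      fibreConnection H, fun _ => 0]]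

/-! ### Smoothness and derivatives of functions pulled back from the base -/

theorem baseProj_contDiff : ContDiff ℝ ∞ baseProj := by
  rw [contDiff_pi]
  intro i
  fin_cases i
  · exact contDiff_apply ℝ ℝ (0 : Fin 4)
  · exact contDiff_apply ℝ ℝ (1 : Fin 4)

theorem totalSpace_isOpen {U : Set (Coord 2)} (hU : IsOpen U) : IsOpen (totalSpace U) :=
  (hU.preimage baseProj_contDiff.continuous).inter
    (isOpen_lt (continuous_apply 2) continuous_const)

theorem hasFDerivAt_coord (i : Fin 4) (p : Coord 4) :
    HasFDerivAt (fun q : Coord 4 => q i) (ContinuousLinearMap.proj (R := ℝ) i) p :=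
  hasFDerivAt_apply i p

theorem hasFDerivAt_comp_baseProj {f : Coord 2 → ℝ} {p : Coord 4}
    (hf : DifferentiableAt ℝ f (baseProj p)) :
    HasFDerivAt (fun q => f (baseProj q))
      (partialDeriv 0 f (baseProj p) • ContinuousLinearMap.proj (R := ℝ) (0 : Fin 4) +
        partialDeriv 1 f (baseProj p) • ContinuousLinearMap.proj (R := ℝ) (1 : Fin 4) :
          Coord 4 →L[ℝ] ℝ) p := by
  have hb : HasFDerivAt baseProj (ContinuousLinearMap.pi ![ContinuousLinearMap.proj (R := ℝ)
      (0 : Fin 4), ContinuousLinearMap.proj (R := ℝ) (1 : Fin 4)] : Coord 4 →L[ℝ] Coord 2) p := by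
    rw [hasFDerivAt_pi']
    intro i
    fin_cases i
    · exact hasFDerivAt_coord 0 p
    · exact hasFDerivAt_coord 1 p
  refine (hf.hasFDerivAt.comp p hb).congr_fderiv ?_
  ext X
  have : (ContinuousLinearMap.pi ![ContinuousLinearMap.proj (R := ℝ)
      (0 : Fin 4), ContinuousLinearMap.proj (R := ℝ) (1 : Fin 4)] : Coord 4 →L[ℝ] Coord 2) X =
      X 0 • basisVec 0 + X 1 • basisVec 1 := by
    ext i
    fin_cases i <;> simp [basisVec]
  simp only [ContinuousLinearMap.comp_apply, this, map_add, map_smul, partialDeriv]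
  simp [mul_comm]

theorem hasFDerivAt_cos_half (p : Coord 4) :
    HasFDerivAt (fun q : Coord 4 => Real.cos (q 3 / 2))
      ((-Real.sin (p 3 / 2) * (1 / 2)) • ContinuousLinearMap.proj (R := ℝ) (3 : Fin 4) :
        Coord 4 →L[ℝ] ℝ) p := by
  have := ((hasFDerivAt_coord 3 p).mul_const (1 / 2 : ℝ)).cos
  simp only [mul_one_div] at this
  refine this.congr_fderiv ?_
  rw [smul_smul]

theorem hasFDerivAt_sin_half (p : Coord 4) :
    HasFDerivAt (fun q : Coord 4 => Real.sin (q 3 / 2))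
      ((Real.cos (p 3 / 2) * (1 / 2)) • ContinuousLinearMap.proj (R := ℝ) (3 : Fin 4) :
        Coord 4 →L[ℝ] ℝ) p := by
  have := ((hasFDerivAt_coord 3 p).mul_const (1 / 2 : ℝ)).sin
  simp only [mul_one_div] at this
  refine this.congr_fderiv ?_
  rw [smul_smul]

theorem partialDeriv_contDiffOn {U : Set (Coord 2)} (hU : IsOpen U) {f : Coord 2 → ℝ}
    (hf : ContDiffOn ℝ ∞ f U) (i : Fin 2) : ContDiffOn ℝ ∞ (partialDeriv i f) U :=
  (hf.fderiv_of_isOpen hU (m := ∞) (by simp)).clm_apply contDiffOn_const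

theorem logFun_contDiffOn {U : Set (Coord 2)} {f : Coord 2 → ℝ}
    (hf : ContDiffOn ℝ ∞ f U) (hpos : ∀ q ∈ U, 0 < f q) : ContDiffOn ℝ ∞ (logFun f) U :=
  hf.log fun q hq => (hpos q hq).ne'

/-- Converts derivatives of `h` and `H` into the logarithmic derivatives that occur in the
connection forms and in `l₂`, `n₂`. -/
theorem partialDeriv_eq_mul_logFun {f : Coord 2 → ℝ} {q : Coord 2} (hf : DifferentiableAt ℝ f q)
    (hpos : 0 < f q) (i : Fin 2) : partialDeriv i f q = f q * partialDeriv i (logFun f) q := by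
  have : HasFDerivAt (logFun f) _ q := hf.hasFDerivAt.log hpos.ne'
  unfold partialDeriv
  rw [this.fderiv]
  simp [hpos.ne']

theorem comp_baseProj_contDiffOn {U : Set (Coord 2)} {f : Coord 2 → ℝ}
    (hf : ContDiffOn ℝ ∞ f U) : ContDiffOn ℝ ∞ (fun p => f (baseProj p)) (totalSpace U) :=
  hf.comp baseProj_contDiff.contDiffOn fun _ hp => hp.1

theorem coord_contDiffOn (M : Set (Coord 4)) (i : Fin 4) :
    ContDiffOn ℝ ∞ (fun p : Coord 4 => p i) M := (contDiff_apply ℝ ℝ i).contDiffOn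

/-! ### The explicit coframe and its first structure equation -/

namespace IsMetricData

variable {U : Set (Coord 2)} {h H : Coord 2 → ℝ} {p : Coord 4}

theorem differentiableAt_of_contDiffOn (d : IsMetricData U h H) {f : Coord 2 → ℝ}
    (hf : ContDiffOn ℝ ∞ f U) {q : Coord 2} (hq : q ∈ U) : DifferentiableAt ℝ f q :=
  (hf.contDiffAt (d.isOpen.mem_nhds hq)).differentiableAt (by simp)

theorem smooth_partialDeriv_log_h (d : IsMetricData U h H) (i : Fin 2) :
    ContDiffOn ℝ ∞ (partialDeriv i (logFun h)) U :=
  partialDeriv_contDiffOn d.isOpen (logFun_contDiffOn d.smooth_h d.pos_h) i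

theorem smooth_partialDeriv_log_H (d : IsMetricData U h H) (i : Fin 2) :
    ContDiffOn ℝ ∞ (partialDeriv i (logFun H)) U :=
  partialDeriv_contDiffOn d.isOpen (logFun_contDiffOn d.smooth_H d.pos_H) i

theorem smooth_lTwo (d : IsMetricData U h H) : ContDiffOn ℝ ∞ (lTwo H) U :=
  (d.smooth_partialDeriv_log_H 1).neg

theorem smooth_nTwo (d : IsMetricData U h H) : ContDiffOn ℝ ∞ (nTwo H) U :=
  d.smooth_partialDeriv_log_H 0

theorem partialDeriv_lTwo (i : Fin 2) (q : Coord 2) :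
    partialDeriv i (lTwo H) q = -partialDeriv i (partialDeriv 1 (logFun H)) q := by
  change fderiv ℝ (fun q => -partialDeriv 1 (logFun H) q) q _ = _
  rw [fderiv_fun_neg]
  rfl

theorem partialDeriv_nTwo (i : Fin 2) (q : Coord 2) :
    partialDeriv i (nTwo H) q = partialDeriv i (partialDeriv 0 (logFun H)) q := rfl

theorem smooth_sin (M : Set (Coord 4)) :
    ContDiffOn ℝ ∞ (fun p : Coord 4 => Real.sin (p 3 / 2)) M :=
  (Real.contDiff_sin.comp ((contDiff_apply ℝ ℝ (3 : Fin 4)).div_const 2)).contDiffOn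

theorem smooth_cos (M : Set (Coord 4)) :
    ContDiffOn ℝ ∞ (fun p : Coord 4 => Real.cos (p 3 / 2)) M :=
  (Real.contDiff_cos.comp ((contDiff_apply ℝ ℝ (3 : Fin 4)).div_const 2)).contDiffOn

theorem isOrthonormalCoframe (d : IsMetricData U h H) :
    IsOrthonormalCoframe (totalSpace U) (metricG h H) (coframe h H) (dualFrame h H) where
  isOpen := totalSpace_isOpen d.isOpen
  smooth a X := by
    have hz := coord_contDiffOn (totalSpace U) 2
    have hh := comp_baseProj_contDiffOn d.smooth_h
    have hH := comp_baseProj_contDiffOn d.smooth_H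
    have hl := comp_baseProj_contDiffOn d.smooth_lTwo
    have hn := comp_baseProj_contDiffOn d.smooth_nTwo
    have hs := smooth_sin (totalSpace U)
    have hc := smooth_cos (totalSpace U)
    fin_cases a
    · exact (hz.mul hh).mul contDiffOn_const
    · exact (hz.mul hh).mul contDiffOn_const
    · exact (((hz.div_const 2).neg.mul contDiffOn_const).add
        (((hc.mul hH).add (hz.mul hl)).mul contDiffOn_const)).add
        (((hs.neg.mul hH).add (hz.mul hn)).mul contDiffOn_const)
    · exact (contDiffOn_const.sub ((hs.mul hH).mul contDiffOn_const)).sub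
        ((hc.mul hH).mul contDiffOn_const)
  smooth_dual a := by
    have hz := coord_contDiffOn (totalSpace U) 2
    have hzi : ContDiffOn ℝ ∞ (fun p : Coord 4 => (p 2)⁻¹) (totalSpace U) :=
      hz.inv fun p hp => hp.2.ne
    have hh := comp_baseProj_contDiffOn d.smooth_h
    have hH := comp_baseProj_contDiffOn d.smooth_H
    have hl := comp_baseProj_contDiffOn d.smooth_lTwo
    have hn := comp_baseProj_contDiffOn d.smooth_nTwo
    have hs := smooth_sin (totalSpace U)
    have hc := smooth_cos (totalSpace U)
    have hi : ContDiffOn ℝ ∞ (fun p : Coord 4 => (p 2 * h (baseProj p))⁻¹) (totalSpace U) :=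
      (hz.mul hh).inv fun p hp => mul_ne_zero hp.2.ne (d.pos_h _ hp.1).ne'
    rw [contDiffOn_pi]
    intro i
    fin_cases a
    · fin_cases i
      · exact hi.mul contDiffOn_const
      · exact hi.mul contDiffOn_const
      · exact hi.mul (hs.mul hH)
      · exact hi.mul ((contDiffOn_const.mul hzi).mul ((hc.mul hH).add (hz.mul hl)))
    · fin_cases i
      · exact hi.mul contDiffOn_const
      · exact hi.mul contDiffOn_const
      · exact hi.mul (hc.mul hH)
      · exact hi.mul ((contDiffOn_const.mul hzi).mul ((hs.neg.mul hH).add (hz.mul hn)))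
    · fin_cases i
      · exact contDiffOn_const
      · exact contDiffOn_const
      · exact contDiffOn_const
      · exact (contDiffOn_const.mul hzi).neg
    · exact contDiffOn_const
  metric p _ X Y := by
    simp [metricG, coframe, Fin.sum_univ_four, dCoord]
    ring
  dual p hp a b := by
    have hz := hp.2.ne
    have hh := (d.pos_h _ hp.1).ne'
    fin_cases a <;> fin_cases b <;>
      simp [coframe, dualFrame, dCoord, thetaThree, thetaFour] <;> field_simp <;> ring
  expand p hp X := by
    have hz := hp.2.ne
    have hh := (d.pos_h _ hp.1).ne'
    ext i
    fin_cases i <;>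
      simp [coframe, dualFrame, dCoord, thetaThree, thetaFour, Fin.sum_univ_four] <;>
      field_simp <;> ring

theorem isConnectionForm (d : IsMetricData U h H) :
    IsConnectionForm (totalSpace U) (coframe h H) (connection h H) where
  smooth a b X := by
    have hh := comp_baseProj_contDiffOn d.smooth_h
    have hl := comp_baseProj_contDiffOn d.smooth_lTwo
    have hn := comp_baseProj_contDiffOn d.smooth_nTwo
    have h0 := comp_baseProj_contDiffOn (d.smooth_partialDeriv_log_h 0)
    have h1 := comp_baseProj_contDiffOn (d.smooth_partialDeriv_log_h 1)
    have hf : ContDiffOn ℝ ∞ (fun p => fibreConnection H p X) (totalSpace U) :=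
      (contDiffOn_const.sub (hl.mul contDiffOn_const)).sub (hn.mul contDiffOn_const)
    have hv : ContDiffOn ℝ ∞ (fun p => horizontalConnection h H p X) (totalSpace U) :=
      ((h1.mul contDiffOn_const).sub (h0.mul contDiffOn_const)).add hf
    have hx : ∀ i, ContDiffOn ℝ ∞ (fun p => h (baseProj p) * X i) (totalSpace U) := fun i =>
      hh.mul contDiffOn_const
    fin_cases a <;> fin_cases b <;>
      first
      | exact contDiffOn_const
      | exact hv
      | exact hf
      | exact hv.neg
      | exact hf.neg
      | exact hx 0
      | exact hx 1
      | exact (hx 0).neg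
      | exact (hx 1).neg
  skew p _ a b X := by
    fin_cases a <;> fin_cases b <;> simp [connection]
  structureEq p hp a X Y := by
    have dh := d.differentiableAt_of_contDiffOn d.smooth_h hp.1
    have dH := d.differentiableAt_of_contDiffOn d.smooth_H hp.1
    have hz := hasFDerivAt_coord 2 p
    have hh := hasFDerivAt_comp_baseProj dh
    have hH := hasFDerivAt_comp_baseProj dH
    have hl := hasFDerivAt_comp_baseProj (d.differentiableAt_of_contDiffOn d.smooth_lTwo hp.1)
    have hn := hasFDerivAt_comp_baseProj (d.differentiableAt_of_contDiffOn d.smooth_nTwo hp.1)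
    have hs := hasFDerivAt_sin_half p
    have hc := hasFDerivAt_cos_half p
    have eh := partialDeriv_eq_mul_logFun dh (d.pos_h _ hp.1)
    have eH := partialDeriv_eq_mul_logFun dH (d.pos_H _ hp.1)
    have hL := d.laplacian_eq _ hp.1
    unfold laplacianPlane at hL
    -- In `c0` to `c3` the right-hand side is left open and is filled in by the derivative computed
    -- from the product rule.
    have c0 : ∀ X Y : Coord 4, dirDeriv (fun q => coframe h H 0 q Y) p X = _ := fun X Y =>
      congrArg (fun L : Coord 4 →L[ℝ] ℝ => L X) ((hz.fun_mul hh).mul_const (Y 0)).fderiv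
    have c1 : ∀ X Y : Coord 4, dirDeriv (fun q => coframe h H 1 q Y) p X = _ := fun X Y =>
      congrArg (fun L : Coord 4 →L[ℝ] ℝ => L X) ((hz.fun_mul hh).mul_const (Y 1)).fderiv
    have c2 : ∀ X Y : Coord 4, dirDeriv (fun q => coframe h H 2 q Y) p X = _ := fun X Y =>
      congrArg (fun L : Coord 4 →L[ℝ] ℝ => L X)
        (((((hz.mul_const (2⁻¹ : ℝ)).fun_neg).mul_const (Y 3)).fun_add
          (((hc.fun_mul hH).fun_add (hz.fun_mul hl)).mul_const (Y 0))).fun_add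
          (((hs.fun_neg.fun_mul hH).fun_add (hz.fun_mul hn)).mul_const (Y 1))).fderiv
    have c3 : ∀ X Y : Coord 4, dirDeriv (fun q => coframe h H 3 q Y) p X = _ := fun X Y =>
      congrArg (fun L : Coord 4 →L[ℝ] ℝ => L X)
        ((((hs.fun_mul hH).mul_const (Y 0)).const_sub (Y 2)).fun_sub
          ((hc.fun_mul hH).mul_const (Y 1))).fderiv
    fin_cases a
    · simp only [Fin.zero_eta, c0]
      simp [connection, coframe, Fin.sum_univ_four, horizontalConnection, fibreConnection,
        thetaThree, thetaFour, dCoord, eh, lTwo, nTwo]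
      ring
    · simp only [Fin.mk_one, c1]
      simp [connection, coframe, Fin.sum_univ_four, horizontalConnection, fibreConnection,
        thetaThree, thetaFour, dCoord, eh, lTwo, nTwo]
      ring
    · simp only [Fin.reduceFinMk, c2]
      simp [connection, coframe, Fin.sum_univ_four, horizontalConnection, fibreConnection,
        thetaThree, thetaFour, dCoord, eH, lTwo, nTwo, partialDeriv_lTwo,
        partialDeriv_nTwo]
      -- The `dx ∧ dy` coefficient of `dθ₃` contains `z Δ ln H`, while the connection terms
      -- contribute `2 z h²`. This is the only structure equation that uses the hypothesis on `H`.
      linear_combination p 2 * (X 0 * Y 1 - X 1 * Y 0) * hL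
    · simp only [Fin.reduceFinMk, c3]
      simp [connection, coframe, Fin.sum_univ_four, horizontalConnection, fibreConnection,
        thetaThree, thetaFour, dCoord, eH, lTwo, nTwo]
      ring

end IsMetricData

/-! ### Curvature -/

theorem dirDeriv_neg (f : Coord 4 → ℝ) (p X : Coord 4) :
    dirDeriv (fun q => -f q) p X = -dirDeriv f p X := by
  unfold dirDeriv
  rw [fderiv_fun_neg]
  rfl

theorem dirDeriv_const (c : ℝ) (p X : Coord 4) : dirDeriv (fun _ => c) p X = 0 := by
  simp [dirDeriv]

namespace IsOrthonormalCoframe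

variable {M : Set (Coord 4)} {g : BilinField} {e : Fin 4 → OneForm} {E : Fin 4 → VecField}
  {p : Coord 4}

/-- The metric trace of `α ⊗ β`. -/
theorem sum_invMetric_mul (he : IsOrthonormalCoframe M g e E) (hp : p ∈ M)
    (α β : Coord 4 →ₗ[ℝ] ℝ) :
    ∑ i, ∑ j, invMetric g p i j * (α (basisVec i) * β (basisVec j)) =
      ∑ a, α (E a p) * β (E a p) := by
  have : ∀ a, α (E a p) * β (E a p) =
      ∑ i, ∑ j, E a p i * E a p j * (α (basisVec i) * β (basisVec j)) := by
    intro a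
    rw [oneForm_apply_eq_sum α, oneForm_apply_eq_sum β, Finset.sum_mul_sum]
    exact Finset.sum_congr rfl fun i _ => Finset.sum_congr rfl fun j _ => by ring
  simp only [this, he.invMetric_eq hp, Finset.sum_mul]
  conv_rhs => rw [Finset.sum_comm]
  exact Finset.sum_congr rfl fun i _ => Finset.sum_comm

end IsOrthonormalCoframe

/-- The coefficient `-(Δ ln h + 4 h²)` of the curvature form `Ω¹₂` with respect to `dx ∧ dy`. -/
def curvatureCoeff (h : Coord 2 → ℝ) (p : Coord 4) : ℝ :=
  -(laplacianPlane (logFun h) (baseProj p) + 4 * h (baseProj p) ^ 2)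

/-- The matrix of the complex structure `E₀ ↦ E₁`, `E₂ ↦ s E₃` for `s = ±1`. -/
def complexMatrix (s : ℝ) : Matrix (Fin 4) (Fin 4) ℝ :=
  !![0, -1, 0, 0; 1, 0, 0, 0; 0, 0, 0, -s; 0, 0, s, 0]

/-- The almost complex structure `E₀ ↦ E₁`, `E₂ ↦ s E₃` for `s = ±1`. -/
def complexStructure (h H : Coord 2 → ℝ) (s : ℝ) : EndField :=
  frameEnd (coframe h H) (dualFrame h H) (complexMatrix s)

theorem coframe_zero (h H : Coord 2 → ℝ) (p X : Coord 4) :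
    coframe h H 0 p X = p 2 * h (baseProj p) * X 0 := rfl

theorem coframe_one (h H : Coord 2 → ℝ) (p X : Coord 4) :
    coframe h H 1 p X = p 2 * h (baseProj p) * X 1 := rfl

namespace IsMetricData

variable {U : Set (Coord 2)} {h H : Coord 2 → ℝ} {p : Coord 4}

/-- The fibre connection `φ` has `dφ = -Δ ln H dx ∧ dy = -2h² dx ∧ dy`. In `Ω²₃` this cancels the
quadratic terms `-2h² dx ∧ dy`; in `Ω⁰₁` it adds to them, and `-Δ ln h` comes from the rest of the
horizontal connection. The mixed forms cancel through `dh = h d ln h`. -/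
theorem curvatureForm_connection (d : IsMetricData U h H) (hp : p ∈ totalSpace U) (a b : Fin 4)
    (X Y : Coord 4) :
    curvatureForm (connection h H) a b p X Y =
      !![0, 1, 0, 0; -1, 0, 0, 0; 0, 0, 0, 0; 0, 0, 0, 0] a b *
        (curvatureCoeff h p * (X 0 * Y 1 - X 1 * Y 0)) := by
  have dh := d.differentiableAt_of_contDiffOn d.smooth_h hp.1
  have hh := hasFDerivAt_comp_baseProj dh
  have hl := hasFDerivAt_comp_baseProj (d.differentiableAt_of_contDiffOn d.smooth_lTwo hp.1)
  have hn := hasFDerivAt_comp_baseProj (d.differentiableAt_of_contDiffOn d.smooth_nTwo hp.1)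
  have hk := fun i => hasFDerivAt_comp_baseProj
    (d.differentiableAt_of_contDiffOn (d.smooth_partialDeriv_log_h i) hp.1)
  have eh := partialDeriv_eq_mul_logFun dh (d.pos_h _ hp.1)
  have hL := d.laplacian_eq _ hp.1
  unfold laplacianPlane at hL
  have cx : ∀ (i : Fin 4) (X Y : Coord 4), dirDeriv (fun q => h (baseProj q) * Y i) p X = _ :=
    fun i X Y => congrArg (fun L : Coord 4 →L[ℝ] ℝ => L X) (hh.mul_const (Y i)).fderiv
  have hf := fun Y : Coord 4 => (((hl.mul_const (Y 0)).const_sub (1 / 2 * Y 3)).fun_sub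
        (hn.mul_const (Y 1)))
  have cf : ∀ X Y : Coord 4, dirDeriv (fun q => fibreConnection H q Y) p X = _ := fun X Y =>
    congrArg (fun L : Coord 4 →L[ℝ] ℝ => L X) (hf Y).fderiv
  have cv : ∀ X Y : Coord 4, dirDeriv (fun q => horizontalConnection h H q Y) p X = _ :=
    fun X Y => congrArg (fun L : Coord 4 →L[ℝ] ℝ => L X)
      ((((hk 1).mul_const (Y 0)).fun_sub ((hk 0).mul_const (Y 1))).fun_add (hf Y)).fderiv
  unfold curvatureForm
  fin_cases a <;> fin_cases b <;>
    simp [connection, Fin.sum_univ_four, dirDeriv_neg, dirDeriv_const, cf, cv, cx, dCoord,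
      curvatureCoeff, laplacianPlane] <;>
    try simp [horizontalConnection, dCoord, eh, partialDeriv_lTwo, partialDeriv_nTwo]
  all_goals first
    -- Only the entries of `Ω⁰₁` and `Ω²₃` and their transposes involve second derivatives of `ln
    -- H`, and hence `hL`.
    | ring1
    | linear_combination (X 0 * Y 1 - X 1 * Y 0) * hL
    | linear_combination -(X 0 * Y 1 - X 1 * Y 0) * hL

theorem apply_curvature (d : IsMetricData U h H) (hp : p ∈ totalSpace U) (X Y Z : Coord 4)
    (a : Fin 4) :
    coframe h H a p (curvature (metricG h H) p X Y Z) =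
      curvatureCoeff h p * (X 0 * Y 1 - X 1 * Y 0) *
        ![coframe h H 1 p Z, -coframe h H 0 p Z, 0, 0] a := by
  rw [d.isOrthonormalCoframe.apply_curvature d.isConnectionForm hp]
  simp only [d.curvatureForm_connection hp, Fin.sum_univ_four]
  fin_cases a <;> simp

theorem curvature_apply_zero (d : IsMetricData U h H) (hp : p ∈ totalSpace U)
    (X Y Z : Coord 4) :
    curvature (metricG h H) p X Y Z 0 =
      curvatureCoeff h p * (X 0 * Y 1 - X 1 * Y 0) * Z 1 := by
  have := d.apply_curvature hp X Y Z 0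
  have hne := mul_ne_zero hp.2.ne (d.pos_h _ hp.1).ne'
  simp only [coframe_zero, coframe_one, Matrix.cons_val_zero] at this
  exact mul_left_cancel₀ hne (by linear_combination this)

theorem curvature_apply_one (d : IsMetricData U h H) (hp : p ∈ totalSpace U)
    (X Y Z : Coord 4) :
    curvature (metricG h H) p X Y Z 1 =
      -(curvatureCoeff h p * (X 0 * Y 1 - X 1 * Y 0) * Z 0) := by
  have := d.apply_curvature hp X Y Z 1
  have hne := mul_ne_zero hp.2.ne (d.pos_h _ hp.1).ne'
  simp only [coframe_zero, coframe_one, Matrix.cons_val_one, Matrix.cons_val_zero] at this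
  exact mul_left_cancel₀ hne (by linear_combination this)

theorem curvature_eq_zero (d : IsMetricData U h H) (hp : p ∈ totalSpace U) {X Y : Coord 4}
    (hXY : X 0 * Y 1 - X 1 * Y 0 = 0) (Z : Coord 4) : curvature (metricG h H) p X Y Z = 0 := by
  refine d.isOrthonormalCoframe.ext hp fun a => ?_
  rw [d.apply_curvature hp, hXY]
  simp

theorem curvature4_eq (d : IsMetricData U h H) (hp : p ∈ totalSpace U) (X Y Z W : Coord 4) :
    curvature4 (metricG h H) p X Y Z W = curvatureCoeff h p * (X 0 * Y 1 - X 1 * Y 0) *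
      (coframe h H 1 p Z * coframe h H 0 p W - coframe h H 0 p Z * coframe h H 1 p W) := by
  unfold curvature4
  rw [d.isOrthonormalCoframe.metric p hp]
  simp only [d.apply_curvature hp, Fin.sum_univ_four]
  simp
  ring

/-- In the trace the directions `∂_z` and `∂_t` drop out, since the curvature vanishes when either
is one of the first two arguments. -/
theorem ricci_eq (d : IsMetricData U h H) (hp : p ∈ totalSpace U) (X Y : Coord 4) :
    ricci (metricG h H) p X Y = curvatureCoeff h p * (X 0 * Y 0 + X 1 * Y 1) := by
  unfold ricci
  rw [Fin.sum_univ_four, d.curvature_apply_zero hp, d.curvature_apply_one hp,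
    d.curvature_eq_zero hp (X := basisVec 2) (by simp [basisVec]),
    d.curvature_eq_zero hp (X := basisVec 3) (by simp [basisVec])]
  simp [basisVec]
  ring

theorem scalarCurvature_eq (d : IsMetricData U h H) (hp : p ∈ totalSpace U) :
    scalarCurvature (metricG h H) p =
      -(2 * laplacianPlane (logFun h) (baseProj p)) / ((p 2) ^ 2 * (h (baseProj p)) ^ 2)
        - 8 / (p 2) ^ 2 := by
  have hz := hp.2.ne
  have hh := (d.pos_h _ hp.1).ne'
  have h0 := d.isOrthonormalCoframe.sum_invMetric_mul hp (dCoord 0) (dCoord 0)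
  have h1 := d.isOrthonormalCoframe.sum_invMetric_mul hp (dCoord 1) (dCoord 1)
  have : scalarCurvature (metricG h H) p = curvatureCoeff h p *
      (∑ i, ∑ j, invMetric (metricG h H) p i j * (dCoord 0 (basisVec i) * dCoord 0 (basisVec j)) +
       ∑ i, ∑ j, invMetric (metricG h H) p i j *
        (dCoord 1 (basisVec i) * dCoord 1 (basisVec j))) := by
    unfold scalarCurvature
    simp only [Finset.mul_sum, ← Finset.sum_add_distrib]
    refine Finset.sum_congr rfl fun i _ => Finset.sum_congr rfl fun j _ => ?_
    rw [d.ricci_eq hp]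
    simp only [dCoord, LinearMap.proj_apply]
    ring
  rw [this, h0, h1]
  simp [Fin.sum_univ_four, dualFrame, dCoord, curvatureCoeff]
  field_simp
  ring

/-- All curvature endomorphisms are multiples of one infinitesimal rotation of the horizontal
components. They commute with each other, and being trace-free there they annihilate the form `dx ∧
dy`. -/
theorem isSemiSymmetric (d : IsMetricData U h H) :
    IsSemiSymmetric (totalSpace U) (metricG h H) := by
  intro p hp X Y Z W V
  refine d.isOrthonormalCoframe.ext hp fun a => ?_
  unfold curvatureDerivation
  simp only [map_sub, map_zero, d.apply_curvature hp, d.curvature_apply_zero hp,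
    d.curvature_apply_one hp]
  fin_cases a
  · simp [coframe_one]
    ring
  · simp [coframe_zero]
    ring
  · simp
  · simp

/-! ### The complex structures -/

theorem apply_complexStructure (d : IsMetricData U h H) (hp : p ∈ totalSpace U) (s : ℝ)
    (X : Coord 4) (a : Fin 4) :
    coframe h H a p (complexStructure h H s p X) =
      ![-coframe h H 1 p X, coframe h H 0 p X, -(s * coframe h H 3 p X),
        s * coframe h H 2 p X] a := by
  unfold complexStructure
  rw [d.isOrthonormalCoframe.apply_frameEnd hp]
  fin_cases a <;> simp [complexMatrix, Fin.sum_univ_four]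

theorem complexStructure_apply_zero (d : IsMetricData U h H) (hp : p ∈ totalSpace U) (s : ℝ)
    (X : Coord 4) : complexStructure h H s p X 0 = -X 1 := by
  have := d.apply_complexStructure hp s X 0
  have hne := mul_ne_zero hp.2.ne (d.pos_h _ hp.1).ne'
  simp only [coframe_zero, coframe_one, Matrix.cons_val_zero] at this
  exact mul_left_cancel₀ hne (by linear_combination this)

theorem complexStructure_apply_one (d : IsMetricData U h H) (hp : p ∈ totalSpace U) (s : ℝ)
    (X : Coord 4) : complexStructure h H s p X 1 = X 0 := by
  have := d.apply_complexStructure hp s X 1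
  have hne := mul_ne_zero hp.2.ne (d.pos_h _ hp.1).ne'
  simp only [coframe_zero, coframe_one, Matrix.cons_val_one, Matrix.cons_val_zero] at this
  exact mul_left_cancel₀ hne (by linear_combination this)

/-- `∇J` vanishes for `s = -1`, and involves only `dx, dy` for `s = 1`. -/
theorem apply_nablaEnd (d : IsMetricData U h H) (hp : p ∈ totalSpace U) (s : ℝ)
    (X Y : Coord 4) (a : Fin 4) :
    coframe h H a p (nablaEnd (metricG h H) (complexStructure h H s) p X Y) =
      (1 + s) * h (baseProj p) *
        ![X 0 * coframe h H 2 p Y + X 1 * coframe h H 3 p Y,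
          X 1 * coframe h H 2 p Y - X 0 * coframe h H 3 p Y,
          -(X 0 * coframe h H 0 p Y) - X 1 * coframe h H 1 p Y,
          X 0 * coframe h H 1 p Y - X 1 * coframe h H 0 p Y] a := by
  unfold complexStructure
  rw [d.isOrthonormalCoframe.apply_nablaEnd_frameEnd d.isConnectionForm hp]
  fin_cases a <;> simp [complexMatrix, Fin.sum_univ_four, connection, dCoord] <;> ring

theorem complexStructure_sq (d : IsMetricData U h H) (hp : p ∈ totalSpace U) {s : ℝ}
    (hs : s * s = 1) (X : Coord 4) :
    complexStructure h H s p (complexStructure h H s p X) = -X := by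
  refine d.isOrthonormalCoframe.ext hp fun a => ?_
  rw [d.apply_complexStructure hp, map_neg]
  fin_cases a <;> simp [d.apply_complexStructure hp, ← mul_assoc, hs]

/-- Integrability comes from writing the Nijenhuis tensor through `∇J`: for `s = -1` everything
vanishes, and for `s = 1` the terms cancel in pairs by `(∇_{JX}J)Y = J(∇_X J)Y`. -/
theorem isHermitian_complexStructure (d : IsMetricData U h H) {s : ℝ} (hs : s * s = 1) :
    IsHermitian (totalSpace U) (metricG h H) (complexStructure h H s) where
  metric := d.isOrthonormalCoframe.isRiemannianMetric
  smooth := d.isOrthonormalCoframe.frameEnd_contDiffOn _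
  sq p hp X := d.complexStructure_sq hp hs X
  orthogonal p hp X Y := by
    rw [d.isOrthonormalCoframe.metric p hp, d.isOrthonormalCoframe.metric p hp]
    simp only [d.apply_complexStructure hp, Fin.sum_univ_four]
    simp
    linear_combination (coframe h H 2 p X * coframe h H 2 p Y +
      coframe h H 3 p X * coframe h H 3 p Y) * hs
  integrable p hp X Y := by
    have hd : ∀ X, DifferentiableAt ℝ (fun q => complexStructure h H s q X) p := fun X =>
      ((d.isOrthonormalCoframe.frameEnd_contDiffOn _ X).contDiffAt
        (d.isOrthonormalCoframe.isOpen.mem_nhds hp)).differentiableAt (by simp)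
    rw [d.isOrthonormalCoframe.nijenhuis_eq d.isConnectionForm hp hd
      (d.complexStructure_sq hp hs)]
    refine d.isOrthonormalCoframe.ext hp fun a => ?_
    simp only [map_add, map_sub, map_zero, d.apply_nablaEnd hp, d.apply_complexStructure hp,
      d.complexStructure_apply_zero hp, d.complexStructure_apply_one hp]
    fin_cases a <;> simp [coframe_zero, coframe_one]
    · ring
    · linear_combination -2 * p 2 * h (baseProj p) ^ 2 * (X 1 * Y 0 - X 0 * Y 1) * hs
    · ring

/-! ### The Kähler forms and their exterior derivatives -/

theorem kahlerForm_apply (d : IsMetricData U h H) (hp : p ∈ totalSpace U) (s : ℝ)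
    (X Y : Coord 4) :
    kahlerForm (metricG h H) (complexStructure h H s) p X Y =
      coframe h H 0 p X * coframe h H 1 p Y - coframe h H 1 p X * coframe h H 0 p Y +
      s * (coframe h H 2 p X * coframe h H 3 p Y - coframe h H 3 p X * coframe h H 2 p Y) := by
  change metricG h H p (complexStructure h H s p X) Y = _
  rw [d.isOrthonormalCoframe.metric p hp]
  simp only [d.apply_complexStructure hp, Fin.sum_univ_four]
  simp
  ring

theorem kahlerForm_eq (d : IsMetricData U h H) (hp : p ∈ totalSpace U) (s : ℝ) :
    kahlerForm (metricG h H) (complexStructure h H s) p =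
      areaForm h p + s • wedge (thetaThree H p) (thetaFour H p) := by
  refine LinearMap.ext fun X => LinearMap.ext fun Y => ?_
  rw [d.kahlerForm_apply hp]
  simp [areaForm, wedge, coframe, dCoord]
  ring

/-- Both `z² ω_Σ` and `θ₃ ∧ θ₄` have exterior derivative `(2/z) θ₄ ∧ z² ω_Σ`, whence the factor `1 +
s`; on the right the summand `θ₄ ∧ θ₃ ∧ θ₄` is zero. -/
theorem extDerivTwo_kahlerForm (d : IsMetricData U h H) (hp : p ∈ totalSpace U) (s : ℝ)
    (X Y Z : Coord 4) :
    extDerivTwo (kahlerForm (metricG h H) (complexStructure h H s)) p X Y Z =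
      (1 + s) * wedgeOneTwo (fun q => -(alphaFun q • thetaFour H q))
        (kahlerForm (metricG h H) (complexStructure h H s)) p X Y Z := by
  have hz := hp.2.ne
  have he := d.isOrthonormalCoframe
  have hd := fun a X => he.differentiableAt hp a X
  have key : ∀ X Y Z : Coord 4,
      dirDeriv (fun q => kahlerForm (metricG h H) (complexStructure h H s) q Y Z) p X =
      (dirDeriv (fun q => coframe h H 0 q Y) p X * coframe h H 1 p Z +
        coframe h H 0 p Y * dirDeriv (fun q => coframe h H 1 q Z) p X) -
      (dirDeriv (fun q => coframe h H 1 q Y) p X * coframe h H 0 p Z +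
        coframe h H 1 p Y * dirDeriv (fun q => coframe h H 0 q Z) p X) +
      s * ((dirDeriv (fun q => coframe h H 2 q Y) p X * coframe h H 3 p Z +
        coframe h H 2 p Y * dirDeriv (fun q => coframe h H 3 q Z) p X) -
      (dirDeriv (fun q => coframe h H 3 q Y) p X * coframe h H 2 p Z +
        coframe h H 3 p Y * dirDeriv (fun q => coframe h H 2 q Z) p X)) := by
    intro X Y Z
    rw [dirDeriv_congr he.isOpen hp (fun q hq => d.kahlerForm_apply hq s Y Z),
      dirDeriv_add (((hd 0 Y).fun_mul (hd 1 Z)).fun_sub ((hd 1 Y).fun_mul (hd 0 Z)))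
        ((((hd 2 Y).fun_mul (hd 3 Z)).fun_sub ((hd 3 Y).fun_mul (hd 2 Z))).const_mul s),
      dirDeriv_const_mul (((hd 2 Y).fun_mul (hd 3 Z)).fun_sub ((hd 3 Y).fun_mul (hd 2 Z))),
      dirDeriv_sub ((hd 0 Y).fun_mul (hd 1 Z)) ((hd 1 Y).fun_mul (hd 0 Z)),
      dirDeriv_sub ((hd 2 Y).fun_mul (hd 3 Z)) ((hd 3 Y).fun_mul (hd 2 Z)),
      dirDeriv_mul (hd 0 Y) (hd 1 Z), dirDeriv_mul (hd 1 Y) (hd 0 Z),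
      dirDeriv_mul (hd 2 Y) (hd 3 Z), dirDeriv_mul (hd 3 Y) (hd 2 Z)]
  have st : ∀ (a : Fin 4) (X Y : Coord 4), _ = _ := fun a X Y =>
    d.isConnectionForm.structureEq p hp a X Y
  unfold extDerivTwo wedgeOneTwo
  rw [key, key, key]
  simp only [d.kahlerForm_apply hp]
  have hα : ∀ X, (-(alphaFun p • thetaFour H p)) X = 2 * (p 2)⁻¹ * coframe h H 3 p X := by
    intro X
    simp [alphaFun, coframe]
    ring
  simp only [hα]
  -- One cyclic term of `de⁰ ∧ e¹ - de¹ ∧ e⁰ + s (de² ∧ e³ - de³ ∧ e²)`, with the structure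
  -- equations inserted; `dΩ` is the sum of three of these.
  have t : ∀ X Y Z : Coord 4, _ = _ := fun X Y Z => congrArg₂ (· + ·)
    (congrArg₂ (· - ·) (congrArg (coframe h H 1 p Z * ·) (st 0 X Y))
      (congrArg (coframe h H 0 p Z * ·) (st 1 X Y)))
    (congrArg (s * ·) (congrArg₂ (· - ·) (congrArg (coframe h H 3 p Z * ·) (st 2 X Y))
      (congrArg (coframe h H 2 p Z * ·) (st 3 X Y))))
  have t1 := t X Y Z
  have t2 := t Y Z X
  have t3 := t Z X Y
  simp only [Fin.sum_univ_four] at t1 t2 t3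
  refine Eq.trans ?_ (Eq.trans (congrArg₂ (· + ·) (congrArg₂ (· + ·) t1 t2) t3) ?_)
  · ring
  · simp [connection, coframe_zero, coframe_one, dCoord]
    field_simp
    ring

theorem isKahler_complexStructure_neg_one (d : IsMetricData U h H) :
    IsKahler (totalSpace U) (metricG h H) (complexStructure h H (-1)) where
  hermitian := d.isHermitian_complexStructure (by norm_num)
  closed p hp X Y Z := by
    rw [d.extDerivTwo_kahlerForm hp]
    ring

end IsMetricData

namespace IsMetricData

variable {U : Set (Coord 2)} {h H : Coord 2 → ℝ} {p : Coord 4}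

/-! ### The nullity distribution -/

theorem coframe_dualFrame (d : IsMetricData U h H) (hp : p ∈ totalSpace U) (a b : Fin 4) :
    coframe h H a p (dualFrame h H b p) = if a = b then 1 else 0 :=
  d.isOrthonormalCoframe.dual p hp a b

theorem mem_nullityDistribution_iff (d : IsMetricData U h H) (hp : p ∈ totalSpace U)
    (X : Coord 4) :
    X ∈ nullityDistribution (metricG h H) (complexStructure h H 1) p ↔ X 0 = 0 ∧ X 1 = 0 := by
  have hh := (d.pos_h _ hp.1).ne'
  constructor
  · intro hX
    -- Testing `∇_X J` on the single vector `E₂` already recovers `X 0` and `X 1`, up to the nonzero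
    -- factor `2h`.
    have h0 := congrArg (coframe h H 0 p) (hX (dualFrame h H 2 p))
    have h1 := congrArg (coframe h H 1 p) (hX (dualFrame h H 2 p))
    rw [d.apply_nablaEnd hp] at h0 h1
    simp [d.coframe_dualFrame hp, hh] at h0 h1
    exact ⟨h0, h1⟩
  · rintro ⟨h0, h1⟩ Y
    refine d.isOrthonormalCoframe.ext hp fun a => ?_
    rw [d.apply_nablaEnd hp]
    fin_cases a <;> simp [h0, h1]

theorem isSmoothRankTwo_nullityDistribution (d : IsMetricData U h H) :
    IsSmoothRankTwo (totalSpace U)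
      (nullityDistribution (metricG h H) (complexStructure h H 1)) := by
  intro p hp
  refine ⟨totalSpace U, totalSpace_isOpen d.isOpen, hp, subset_rfl, fun _ => basisVec 2,
    fun _ => basisVec 3, contDiffOn_const, contDiffOn_const, fun q hq => ⟨?_, ?_⟩⟩
  · rw [LinearIndependent.pair_iff]
    intro s t hst
    have h2 := congrFun hst 2
    have h3 := congrFun hst 3
    simp [basisVec] at h2 h3
    exact ⟨h2, h3⟩
  · ext X
    rw [d.mem_nullityDistribution_iff hq, SetLike.mem_coe, Submodule.mem_span_pair]
    constructor
    · rintro ⟨h0, h1⟩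
      refine ⟨X 2, X 3, ?_⟩
      ext i
      fin_cases i <;> simp [basisVec, h0, h1]
    · rintro ⟨s, t, rfl⟩
      simp [basisVec]

theorem dualFrame_mem_nullityDistribution (d : IsMetricData U h H) (hp : p ∈ totalSpace U) :
    dualFrame h H 2 p ∈ nullityDistribution (metricG h H) (complexStructure h H 1) p ∧
      dualFrame h H 3 p ∈ nullityDistribution (metricG h H) (complexStructure h H 1) p := by
  rw [d.mem_nullityDistribution_iff hp, d.mem_nullityDistribution_iff hp]
  simp [dualFrame]

theorem metric_dualFrame (d : IsMetricData U h H) (hp : p ∈ totalSpace U) (X : Coord 4)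
    (a : Fin 4) : metricG h H p X (dualFrame h H a p) = coframe h H a p X := by
  rw [d.isOrthonormalCoframe.metric p hp]
  simp [d.coframe_dualFrame hp]

theorem isOppositeAlong_complexStructure (d : IsMetricData U h H) :
    IsOppositeAlong (totalSpace U) (metricG h H) (complexStructure h H 1)
      (complexStructure h H (-1))
      (nullityDistribution (metricG h H) (complexStructure h H 1)) := by
  refine fun p hp => ⟨fun X hX => ?_, fun X hX => ?_⟩
  · rw [d.mem_nullityDistribution_iff hp] at hX
    refine d.isOrthonormalCoframe.ext hp fun a => ?_
    rw [map_neg, d.apply_complexStructure hp, d.apply_complexStructure hp]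
    fin_cases a <;> simp [coframe_zero, coframe_one, hX.1, hX.2]
  · have h2 := hX _ (d.dualFrame_mem_nullityDistribution hp).1
    have h3 := hX _ (d.dualFrame_mem_nullityDistribution hp).2
    rw [d.metric_dualFrame hp] at h2 h3
    refine d.isOrthonormalCoframe.ext hp fun a => ?_
    rw [d.apply_complexStructure hp, d.apply_complexStructure hp]
    fin_cases a <;> simp [h2, h3]

/-- The last two conditions express `J`-invariance of the form, automatic because the two structures
commute. The first uses that `X, Y` is a unitary basis. -/
theorem isAntiSelfDual_kahlerForm (d : IsMetricData U h H) :
    IsAntiSelfDual (totalSpace U) (metricG h H) (complexStructure h H 1)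
      (kahlerForm (metricG h H) (complexStructure h H (-1))) := by
  intro p hp X Y hX hY hXY hJXY
  rw [d.isOrthonormalCoframe.metric p hp] at hX hY hXY hJXY
  simp only [d.apply_complexStructure hp, Fin.sum_univ_four] at hX hY hXY hJXY
  simp only [d.kahlerForm_apply hp, d.apply_complexStructure hp]
  simp at hX hY hXY hJXY ⊢
  generalize coframe h H 0 p X = x0 at *
  generalize coframe h H 1 p X = x1 at *
  generalize coframe h H 2 p X = x2 at *
  generalize coframe h H 3 p X = x3 at *
  generalize coframe h H 0 p Y = y0 at *
  generalize coframe h H 1 p Y = y1 at *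
  generalize coframe h H 2 p Y = y2 at *
  generalize coframe h H 3 p Y = y3 at *
  -- The complex 2×2 matrix with columns `X`, `Y` is unitary, so its first row also has length one.
  have hP : x0 * x0 + x1 * x1 + (y0 * y0 + y1 * y1) = 1 := by
    linear_combination (x0 * y0 + x1 * y1 - x2 * y2 - x3 * y3) * hXY +
      (x0 * y1 - x1 * y0 - x2 * y3 + x3 * y2) * hJXY +
      (y2 * y2 + y3 * y3) * hX + (1 - x0 * x0 - x1 * x1) * hY
  refine ⟨?_, ?_, ?_⟩
  · linear_combination 2 * hP - hX - hY
  · ring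
  · ring

/-! ### The Lee form -/

/-- In dimension four, wedging 1-forms with the nondegenerate `Ω` is injective. -/
theorem lee_form_unique (d : IsMetricData U h H) (hp : p ∈ totalSpace U) {θ : OneForm}
    (hθ : ∀ X Y Z, extDerivTwo (kahlerForm (metricG h H) (complexStructure h H 1)) p X Y Z =
      2 * wedgeOneTwo θ (kahlerForm (metricG h H) (complexStructure h H 1)) p X Y Z) :
    θ p = -(alphaFun p • thetaFour H p) := by
  have key : ∀ X Y Z, wedgeOneTwo θ (kahlerForm (metricG h H) (complexStructure h H 1)) p X Y Z =
      wedgeOneTwo (fun q => -(alphaFun q • thetaFour H q))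
        (kahlerForm (metricG h H) (complexStructure h H 1)) p X Y Z := by
    intro X Y Z
    have h1 := hθ X Y Z
    rw [d.extDerivTwo_kahlerForm hp] at h1
    linear_combination -(1 / 2) * h1
  unfold wedgeOneTwo at key
  have hE : ∀ a, θ p (dualFrame h H a p) =
      (-(alphaFun p • thetaFour H p)) (dualFrame h H a p) := by
    intro a
    -- For each `a`, pairing `E_a` with the `J`-plane not containing it isolates `θ(E_a)`.
    have k0 := key (dualFrame h H a p) (dualFrame h H 0 p) (dualFrame h H 1 p)
    have k2 := key (dualFrame h H a p) (dualFrame h H 2 p) (dualFrame h H 3 p)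
    simp only [d.kahlerForm_apply hp, d.coframe_dualFrame hp] at k0 k2
    fin_cases a
    · simpa using k2
    · simpa using k2
    · simpa using k0
    · simpa using k0
  refine LinearMap.ext fun X => ?_
  rw [d.isOrthonormalCoframe.expand p hp X]
  simp only [map_sum, map_smul, hE]

theorem isLeeForm_iff (d : IsMetricData U h H) (θ : OneForm) :
    IsLeeForm (totalSpace U) (metricG h H) (complexStructure h H 1) θ ↔
      ∀ p ∈ totalSpace U, θ p = -(alphaFun p • thetaFour H p) := by
  refine ⟨fun hθ p hp => d.lee_form_unique hp (hθ p hp), fun hθ p hp X Y Z => ?_⟩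
  rw [d.extDerivTwo_kahlerForm hp]
  unfold wedgeOneTwo
  rw [hθ p hp]
  ring

theorem dirDeriv_alphaFun_smul_thetaFour (d : IsMetricData U h H) (hp : p ∈ totalSpace U)
    {θ : OneForm} (hθ : ∀ p ∈ totalSpace U, θ p = -(alphaFun p • thetaFour H p))
    (X Y : Coord 4) :
    dirDeriv (fun q => θ q Y) p X = -(2 * (p 2)⁻¹ ^ 2 * X 2) * coframe h H 3 p Y +
      2 * (p 2)⁻¹ * dirDeriv (fun q => coframe h H 3 q Y) p X := by
  have hz := hp.2.ne
  have h1 : ∀ q ∈ totalSpace U, θ q Y = 2 * (q 2)⁻¹ * coframe h H 3 q Y := by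
    intro q hq
    rw [hθ q hq]
    simp [alphaFun, coframe]
    ring
  have h2 : HasFDerivAt (fun q : Coord 4 => 2 * (q 2)⁻¹) _ p :=
    ((hasDerivAt_inv hz).comp_hasFDerivAt p (hasFDerivAt_coord 2 p)).const_mul 2
  rw [dirDeriv_congr d.isOrthonormalCoframe.isOpen hp h1,
    dirDeriv_mul h2.differentiableAt (d.isOrthonormalCoframe.differentiableAt hp 3 Y)]
  congr 2
  unfold dirDeriv
  rw [h2.fderiv]
  simp
  ring

/-- Written as a sum of tensor products of 1-forms, so that the trace can be taken with
`sum_invMetric_mul`. -/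
theorem nablaForm_lee (d : IsMetricData U h H) (hp : p ∈ totalSpace U)
    {θ : OneForm} (hθ : ∀ p ∈ totalSpace U, θ p = -(alphaFun p • thetaFour H p))
    (X Y : Coord 4) :
    nablaForm (metricG h H) θ p X Y =
      -(2 * (p 2)⁻¹ ^ 2) * (dCoord 2 X * coframe h H 3 p Y) -
        2 * (p 2)⁻¹ * (fibreConnection H p X * coframe h H 2 p Y) +
        2 * (p 2)⁻¹ * h (baseProj p) * (dCoord 0 X * coframe h H 0 p Y) +
        2 * (p 2)⁻¹ * h (baseProj p) * (dCoord 1 X * coframe h H 1 p Y) := by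
  have h1 : ∀ Y, θ p Y = 2 * (p 2)⁻¹ * coframe h H 3 p Y := by
    intro Y
    rw [hθ p hp]
    simp [alphaFun, coframe]
    ring
  unfold nablaForm
  rw [d.dirDeriv_alphaFun_smul_thetaFour hp hθ, h1,
    d.isOrthonormalCoframe.apply_leviCivita_const d.isConnectionForm hp]
  simp [Fin.sum_univ_four, connection, dCoord]
  ring

theorem codifferential_lee (d : IsMetricData U h H) (hp : p ∈ totalSpace U)
    {θ : OneForm} (hθ : ∀ p ∈ totalSpace U, θ p = -(alphaFun p • thetaFour H p)) :
    codifferential (metricG h H) θ p = -(4 * (p 2)⁻¹ ^ 2) := by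
  have hz := hp.2.ne
  have hh := (d.pos_h _ hp.1).ne'
  have tr := fun α a => d.isOrthonormalCoframe.sum_invMetric_mul hp α (coframe h H a p)
  have t0 := tr (dCoord 0) 0
  have t1 := tr (dCoord 1) 1
  have t2 := tr (fibreConnection H p) 2
  have t3 := tr (dCoord 2) 3
  have hsum : codifferential (metricG h H) θ p = -(
      -(2 * (p 2)⁻¹ ^ 2) * ∑ i, ∑ j, invMetric (metricG h H) p i j *
        (dCoord 2 (basisVec i) * coframe h H 3 p (basisVec j)) -
      2 * (p 2)⁻¹ * ∑ i, ∑ j, invMetric (metricG h H) p i j *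
        (fibreConnection H p (basisVec i) * coframe h H 2 p (basisVec j)) +
      2 * (p 2)⁻¹ * h (baseProj p) * ∑ i, ∑ j, invMetric (metricG h H) p i j *
        (dCoord 0 (basisVec i) * coframe h H 0 p (basisVec j)) +
      2 * (p 2)⁻¹ * h (baseProj p) * ∑ i, ∑ j, invMetric (metricG h H) p i j *
        (dCoord 1 (basisVec i) * coframe h H 1 p (basisVec j))) := by
    unfold codifferential
    simp only [Finset.mul_sum, ← Finset.sum_add_distrib, ← Finset.sum_sub_distrib]
    refine congrArg Neg.neg (Finset.sum_congr rfl fun i _ => Finset.sum_congr rfl fun j _ => ?_)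
    rw [d.nablaForm_lee hp hθ]
    ring
  -- With coefficients included, the four traces contribute `-2/z²`, `2/z²`, `2/z²` and `2/z²`.
  rw [hsum, t0, t1, t2, t3]
  simp [d.coframe_dualFrame hp]
  simp [dualFrame, dCoord, fibreConnection]
  field_simp
  ring

theorem normSqForm_lee (d : IsMetricData U h H) (hp : p ∈ totalSpace U)
    {θ : OneForm} (hθ : ∀ p ∈ totalSpace U, θ p = -(alphaFun p • thetaFour H p)) :
    normSqForm (metricG h H) θ p = 4 * (p 2)⁻¹ ^ 2 := by
  have h1 : ∀ Y, θ p Y = 2 * (p 2)⁻¹ * coframe h H 3 p Y := by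
    intro Y
    rw [hθ p hp]
    simp [alphaFun, coframe]
    ring
  have t := d.isOrthonormalCoframe.sum_invMetric_mul hp (θ p) (θ p)
  simp only [← mul_assoc] at t
  unfold normSqForm
  rw [t]
  simp [h1, d.coframe_dualFrame hp]
  ring

theorem conformalScalarCurvature_eq (d : IsMetricData U h H) (hp : p ∈ totalSpace U)
    {θ : OneForm} (hθ : ∀ p ∈ totalSpace U, θ p = -(alphaFun p • thetaFour H p)) :
    conformalScalarCurvature (metricG h H) θ p = scalarCurvature (metricG h H) p := by
  unfold conformalScalarCurvature
  rw [d.normSqForm_lee hp hθ, d.codifferential_lee hp hθ]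
  ring

/-! ### Failure of the locally conformally Kähler condition -/

theorem kahlerForm_differentiableAt (d : IsMetricData U h H) (hp : p ∈ totalSpace U) (s : ℝ)
    (X Y : Coord 4) : DifferentiableAt ℝ
      (fun q => kahlerForm (metricG h H) (complexStructure h H s) q X Y) p := by
  have hd := fun a X => d.isOrthonormalCoframe.differentiableAt hp a X
  refine DifferentiableAt.congr_of_eventuallyEq
    ((((hd 0 X).fun_mul (hd 1 Y)).fun_sub ((hd 1 X).fun_mul (hd 0 Y))).fun_add
      ((((hd 2 X).fun_mul (hd 3 Y)).fun_sub ((hd 3 X).fun_mul (hd 2 Y))).const_mul s)) ?_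
  filter_upwards [d.isOrthonormalCoframe.isOpen.mem_nhds hp] with q hq
  exact d.kahlerForm_apply hq s X Y

/-- The Lee form is not closed. -/
theorem lee_form_not_closed (d : IsMetricData U h H) (hp : p ∈ totalSpace U) :
    ¬ ∀ X Y, dirDeriv (fun q => (-(alphaFun q • thetaFour H q)) Y) p X =
      dirDeriv (fun q => (-(alphaFun q • thetaFour H q)) X) p Y := by
  intro hcl
  have hz := hp.2.ne
  have hH := (d.pos_H _ hp.1).ne'
  -- The structure equation gives `dθ₄(∂_z, Y) = 0`, so closedness of `(2/z) θ₄` tested on `∂_z`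
  -- forces `θ₄ = dz` at `p`.
  have key : ∀ Y, thetaFour H p Y = Y 2 := by
    intro Y
    have h1 := hcl (basisVec 2) Y
    rw [d.dirDeriv_alphaFun_smul_thetaFour hp (fun _ _ => rfl),
      d.dirDeriv_alphaFun_smul_thetaFour hp (fun _ _ => rfl)] at h1
    have h2 := d.isConnectionForm.structureEq p hp 3 (basisVec 2) Y
    simp only [Fin.sum_univ_four] at h2
    have h3 : 2 * (p 2)⁻¹ ^ 2 * (coframe h H 3 p Y - Y 2 * coframe h H 3 p (basisVec 2)) =
        2 * (p 2)⁻¹ * (dirDeriv (fun q => coframe h H 3 q Y) p (basisVec 2) -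
          dirDeriv (fun q => coframe h H 3 q (basisVec 2)) p Y) := by
      have : (basisVec 2 : Coord 4) 2 = 1 := by simp [basisVec]
      rw [this] at h1
      linear_combination -h1
    rw [h2] at h3
    simp [connection, coframe, dCoord, basisVec, thetaThree, thetaFour, fibreConnection, hz] at h3
    simp [thetaFour, dCoord]
    linear_combination h3
  -- On `∂_x` and `∂_y` this makes both `sin(t/2)` and `cos(t/2)` zero, as `H ≠ 0`.
  have h0 := key (basisVec 0)
  have h1 := key (basisVec 1)
  simp [thetaFour, dCoord, basisVec, hH] at h0 h1
  have := Real.sin_sq_add_cos_sq (p 3 / 2)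
  rw [h0, h1] at this
  norm_num at this

theorem not_isLocallyConformallyKahler (d : IsMetricData U h H) (hne : U.Nonempty) :
    ¬ IsLocallyConformallyKahler (totalSpace U) (metricG h H) (complexStructure h H 1) := by
  rintro ⟨-, hlck⟩
  obtain ⟨q, hq⟩ := hne
  have hp : (![q 0, q 1, -1, 0] : Coord 4) ∈ totalSpace U := by
    refine ⟨?_, by simp⟩
    convert hq using 1
    ext i
    fin_cases i <;> simp [baseProj]
  obtain ⟨V, hV, hpV, hVM, u, hu, hK⟩ := hlck _ hp
  refine d.lee_form_not_closed hp fun X Y => ?_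
  -- From `d(e^u Ω) = 0` follows `dΩ = -du ∧ Ω`, so by uniqueness the Lee form is `-½ du` on `V`,
  -- which is closed.
  have hdu : ∀ x ∈ V, ∀ X, (-(alphaFun x • thetaFour H x)) X = -(1 / 2) * dirDeriv u x X := by
    intro x hx
    have hud : DifferentiableAt ℝ u x :=
      (hu.contDiffAt (hV.mem_nhds hx)).differentiableAt (by simp)
    have hprod : ∀ X Y Z, dirDeriv (fun r => kahlerForm (fun q => Real.exp (u q) • metricG h H q)
        (complexStructure h H 1) r Y Z) x X = Real.exp (u x) *
          (dirDeriv u x X * kahlerForm (metricG h H) (complexStructure h H 1) x Y Z +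
            dirDeriv (fun r => kahlerForm (metricG h H) (complexStructure h H 1) r Y Z) x X) := by
      intro X Y Z
      have : dirDeriv (fun r => Real.exp (u r)) x X = Real.exp (u x) * dirDeriv u x X := by
        unfold dirDeriv
        rw [hud.hasFDerivAt.exp.fderiv]
        simp
      change dirDeriv (fun r => Real.exp (u r) *
        kahlerForm (metricG h H) (complexStructure h H 1) r Y Z) x X = _
      rw [dirDeriv_mul hud.exp (d.kahlerForm_differentiableAt (hVM hx) 1 Y Z), this]
      ring
    have hLee := d.lee_form_unique (hVM hx)
      (θ := fun r => (-(1 / 2) : ℝ) • (fderiv ℝ u r : Coord 4 →ₗ[ℝ] ℝ)) (by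
        intro X Y Z
        have h1 := hK.closed x hx X Y Z
        unfold extDerivTwo at h1 ⊢
        rw [hprod, hprod, hprod, ← mul_add, ← mul_add] at h1
        have h2 := (mul_eq_zero.1 h1).resolve_left (Real.exp_pos _).ne'
        unfold dirDeriv at h2 ⊢
        simp only [wedgeOneTwo, LinearMap.smul_apply, ContinuousLinearMap.coe_coe, smul_eq_mul]
        linear_combination h2)
    intro X
    rw [← hLee]
    rfl
  rw [dirDeriv_congr hV hpV (fun x hx => hdu x hx Y), dirDeriv_congr hV hpV
    (fun x hx => hdu x hx X)]
  have hup := hu.contDiffAt (hV.mem_nhds hpV)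
  rw [dirDeriv_const_mul (dirDeriv_differentiableAt hup Y),
    dirDeriv_const_mul (dirDeriv_differentiableAt hup X), dirDeriv_dirDeriv_comm hup]

/-! ### The holomorphic curvature -/

theorem isQCH_complexStructure (d : IsMetricData U h H) :
    IsQCH (totalSpace U) (metricG h H) (complexStructure h H (-1))
      (nullityDistribution (metricG h H) (complexStructure h H 1)) where
  kahler := d.isKahler_complexStructure_neg_one
  rankTwo := d.isSmoothRankTwo_nullityDistribution
  invariant p hp X hX := by
    rw [d.mem_nullityDistribution_iff hp] at hX ⊢
    rw [d.complexStructure_apply_zero hp, d.complexStructure_apply_one hp]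
    simp [hX.1, hX.2]
  curvature := by
    -- Here `s` is the length of the projection onto the distribution, so `1 - s²` is the squared
    -- length of the horizontal part. Dividing by `(z h)²` expresses `dx ∧ dy` in the orthonormal
    -- coframe.
    refine ⟨fun p s => curvatureCoeff h p * ((p 2 * h (baseProj p)) ^ 2)⁻¹ * (1 - s ^ 2) ^ 2,
      fun p hp X X' hX hX' horth => ?_⟩
    have he := d.isOrthonormalCoframe
    have h2 := horth _ (d.dualFrame_mem_nullityDistribution hp).1
    have h3 := horth _ (d.dualFrame_mem_nullityDistribution hp).2
    rw [d.metric_dualFrame hp, map_sub, sub_eq_zero] at h2 h3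
    rw [d.mem_nullityDistribution_iff hp] at hX'
    beta_reduce
    rw [Real.sq_sqrt (by
      rw [he.metric p hp]; exact Finset.sum_nonneg fun a _ => mul_self_nonneg _)]
    have hn : 1 - metricG h H p X' X' =
        coframe h H 0 p X * coframe h H 0 p X + coframe h H 1 p X * coframe h H 1 p X := by
      rw [← hX, he.metric p hp, he.metric p hp, Fin.sum_univ_four, Fin.sum_univ_four, h2, h3,
        coframe_zero h H p X', coframe_one h H p X', hX'.1, hX'.2]
      ring
    rw [hn, d.curvature4_eq hp]
    simp only [d.apply_complexStructure hp, d.complexStructure_apply_zero hp,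
      d.complexStructure_apply_one hp, coframe_zero, coframe_one]
    have hz := hp.2.ne
    have hh := (d.pos_h _ hp.1).ne'
    simp
    field_simp

end IsMetricData

end

/-! ### The main theorem -/

theorem theorem1 (U : Set (Coord 2)) (hU : IsOpen U) (hne : U.Nonempty)
    (h H : Coord 2 → ℝ) (h_smooth : ContDiffOn ℝ ∞ h U) (H_smooth : ContDiffOn ℝ ∞ H U)
    (h_pos : ∀ q ∈ U, 0 < h q) (H_pos : ∀ q ∈ U, 0 < H q)
    (H_eq : ∀ q ∈ U, laplacianPlane (logFun H) q = 2 * (h q) ^ 2) :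
    IsRiemannianMetric (totalSpace U) (metricG h H) ∧
    ∃ Jbar J : EndField,
      -- the Kähler structure with Kähler form `z² ω_Σ + θ₄ ∧ θ₃`
      IsKahler (totalSpace U) (metricG h H) Jbar ∧
      (∀ p ∈ totalSpace U, kahlerForm (metricG h H) Jbar p =
        areaForm h p + wedge (thetaFour H p) (thetaThree H p)) ∧
      -- the opposite Hermitian structure with Kähler form `z² ω_Σ + θ₃ ∧ θ₄`
      IsHermitian (totalSpace U) (metricG h H) J ∧
      (∀ p ∈ totalSpace U, kahlerForm (metricG h H) J p =
        areaForm h p + wedge (thetaThree H p) (thetaFour H p)) ∧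
      IsOppositeHermitian (totalSpace U) (metricG h H) J Jbar ∧
      IsOppositeAlong (totalSpace U) (metricG h H) J Jbar
        (nullityDistribution (metricG h H) J) ∧
      -- the Ricci tensor is `J`-invariant, and `J` is not locally conformally Kähler
      HasInvariantRicci (totalSpace U) (metricG h H) J ∧
      ¬ IsLocallyConformallyKahler (totalSpace U) (metricG h H) J ∧
      -- the Lee form of `J` is `-α θ₄`
      (∀ θ : OneForm, IsLeeForm (totalSpace U) (metricG h H) J θ ↔
        ∀ p ∈ totalSpace U, θ p = -(alphaFun p • thetaFour H p)) ∧
      -- the scalar curvature, which equals the conformal scalar curvature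
      (∀ p ∈ totalSpace U, scalarCurvature (metricG h H) p =
        -(2 * laplacianPlane (logFun h) (baseProj p)) / ((p 2) ^ 2 * (h (baseProj p)) ^ 2)
          - 8 / (p 2) ^ 2) ∧
      (∀ θ : OneForm, IsLeeForm (totalSpace U) (metricG h H) J θ →
        ∀ p ∈ totalSpace U,
          conformalScalarCurvature (metricG h H) θ p = scalarCurvature (metricG h H) p) ∧
      -- the surface is a semi-symmetric QCH Kähler surface
      IsQCH (totalSpace U) (metricG h H) Jbar (nullityDistribution (metricG h H) J) ∧
      IsSemiSymmetric (totalSpace U) (metricG h H) ∧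
      SatisfiesG1 (totalSpace U) (metricG h H) J := by
  have d : IsMetricData U h H := ⟨hU, h_smooth, H_smooth, h_pos, H_pos, H_eq⟩
  refine ⟨d.isOrthonormalCoframe.isRiemannianMetric, complexStructure h H (-1),
    complexStructure h H 1, d.isKahler_complexStructure_neg_one, fun p hp => ?_,
    d.isHermitian_complexStructure (by norm_num), fun p hp => ?_,
    ⟨d.isHermitian_complexStructure (by norm_num), d.isHermitian_complexStructure (by norm_num),
      d.isAntiSelfDual_kahlerForm⟩,
    d.isOppositeAlong_complexStructure, fun p hp X Y => ?_,
    d.not_isLocallyConformallyKahler hne, d.isLeeForm_iff, fun p hp => d.scalarCurvature_eq hp,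
    fun θ hθ p hp => d.conformalScalarCurvature_eq hp ((d.isLeeForm_iff θ).1 hθ),
    d.isQCH_complexStructure, d.isSemiSymmetric, fun p hp X Y Z W => ?_⟩
  · rw [d.kahlerForm_eq hp]
    unfold wedge
    module
  · rw [d.kahlerForm_eq hp, one_smul]
  -- On the `(x, y)` components `J` is a quarter turn, which preserves both `dx² + dy²` (Ricci) and
  -- `dx ∧ dy` (the Gray condition below).
  · rw [d.ricci_eq hp, d.ricci_eq hp]
    simp only [d.complexStructure_apply_zero hp, d.complexStructure_apply_one hp]
    ring
  · rw [d.curvature4_eq hp, d.curvature4_eq hp]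
    simp only [d.complexStructure_apply_zero hp, d.complexStructure_apply_one hp]
    ring
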